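/- Let $n\ge 0$ be an integer and let $q$ be a nonzero complex number; if $n\ge 4$, assume also that $q^2\neq -1$ (that is, $[2]=q+q^{-1}\ne 0$). Fix a square root $q^{1/2}$ of $q$. Let $U'_q(\mathrm{so}_n)$ be the unital associative complex algebra generated by $I_{21},I_{32},\dots,I_{n,n-1}$ subject to the relations $$I_{i,i-1}^2I_{i+1,i}-(q+q^{-1})I_{i,i-1}I_{i+1,i}I_{i,i-1}+I_{i+1,i}I_{i,i-1}^2=-I_{i+1,i},$$ $$I_{i,i-1}I_{i+1,i}^2-(q+q^{-1})I_{i+1,i}I_{i,i-1}I_{i+1,i}+I_{i+1,i}^2I_{i,i-1}=-I_{i,i-1},$$ $$I_{i,i-1}I_{j,j-1}-I_{j,j-1}I_{i,i-1}=0\quad\text{for } |i-j|>1.$$ Put $I^{\pm}_{k,k-1}=I_{k,k-1}$ and, for $k>l+1$, define recursively $$I^{\pm}_{kl}=q^{\pm1/2}I_{l+1,l}I^{\pm}_{k,l+1}-q^{\mp1/2}I^{\pm}_{k,l+1}I_{l+1,l}.$$ Then the ordered monomials $$(I^+_{21})^{m_{21}}(I^+_{31})^{m_{31}}(I^+_{32})^{m_{32}}\cdots(I^+_{n1})^{m_{n1}}\cdots(I^+_{n,n-1})^{m_{n,n-1}},\qquad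 m_{ij}=0,1,2,\dots,$$ are pairwise distinct and form a basis of the complex vector space $U'_q(\mathrm{so}_n)$. The same holds with every $I^+_{ij}$ replaced by $I^-_{ij}$. -/

import Mathlib

noncomputable section

namespace QSo

/-- Labels of the generators: with rows and columns numbered `0, …, n - 1`, the label `i`
(where `i + 1 < n`) stands for the generator `I_{i+1,i}`
(that is, `I_{i+2,i+1}` if rows and columns are numbered from `1`). -/
abbrev GenIdx (n : ℕ) : Type := {i : ℕ // i + 1 < n}

/-- The generator `I_{i+1,i}` as an element of the free algebra. -/
abbrev X {n : ℕ} (i : GenIdx n) : FreeAlgebra ℂ (GenIdx n) := FreeAlgebra.ι ℂ i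

/-- The defining relations of `U'_q(so_n)`. -/
inductive Rel (n : ℕ) (q : ℂ) :
    FreeAlgebra ℂ (GenIdx n) → FreeAlgebra ℂ (GenIdx n) → Prop
  | serre_left (i j : GenIdx n) (hij : j.1 = i.1 + 1) :
      Rel n q
        (X i ^ 2 * X j - (q + q⁻¹) • (X i * X j * X i) + X j * X i ^ 2)
        (-X j)
  | serre_right (i j : GenIdx n) (hij : j.1 = i.1 + 1) :
      Rel n q
        (X i * X j ^ 2 - (q + q⁻¹) • (X j * X i * X j) + X j ^ 2 * X i)
        (-X i)
  | comm (i j : GenIdx n) (hij : i.1 + 1 < j.1 ∨ j.1 + 1 < i.1) :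
      Rel n q (X i * X j - X j * X i) 0

/-- The nonstandard deformation `U'_q(so_n)`: the unital associative complex algebra generated
by the `I_{i+1,i}` subject to the defining relations. -/
abbrev U (n : ℕ) (q : ℂ) : Type := RingQuot (Rel n q)

/-- The generator `I_{i+1,i}` of `U'_q(so_n)`. -/
def gen (n : ℕ) (q : ℂ) (i : GenIdx n) : U n q := RingQuot.mkAlgHom ℂ (Rel n q) (X i)

/-- The bracket `r a b - r⁻¹ b a`; with `r = q^{1/2}` it is `[a, b]_q`, and with
`r = q^{-1/2}` it is `[a, b]_{q⁻¹}`. -/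
def qBracket {A : Type*} [Ring A] [Algebra ℂ A] (r : ℂ) (a b : A) : A :=
  r • (a * b) - r⁻¹ • (b * a)

/-- The elements `I_{kl}`, `l < k`, given by the generator if `k = l + 1` and by
`I_{kl} = r I_{l+1,l} I_{k,l+1} - r⁻¹ I_{k,l+1} I_{l+1,l}` if `k > l + 1`. Taking
`r = q^{1/2}` gives `I⁺_{kl}`, and taking `r = q^{-1/2}` gives `I⁻_{kl}`. -/
def I (n : ℕ) (q r : ℂ) (k l : ℕ) (hlk : l < k) (hk : k < n) : U n q :=
  if h : k = l + 1 then gen n q ⟨l, by omega⟩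
  else qBracket r (gen n q ⟨l, by omega⟩) (I n q r k (l + 1) (by omega) hk)
termination_by k - l

/-- Exponents `m_{kl} ∈ ℕ`, one for each pair of indices `l < k < n`. -/
abbrev Exponents (n : ℕ) : Type := (k : Fin n) → Fin (k : ℕ) → ℕ

/-- The ordered monomial: the product of the `I_{kl} ^ m_{kl}`, with `k` increasing from left to
right and, for each `k`, with `l` increasing from left to right. -/
def monomial (n : ℕ) (q r : ℂ) (m : Exponents n) : U n q :=
  (List.ofFn fun k : Fin n =>
    (List.ofFn fun l : Fin (k : ℕ) => I n q r k l l.isLt k.isLt ^ m k l).prod).prod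

end QSo

end

noncomputable section

namespace QSo

/-! The proof has two independent halves, and both see $q$ only through $q+q^{-1}=r^2+r^{-2}$. This
is symmetric under $r\mapsto r^{-1}$, so one argument serves $I^+$ (with $r=q^{1/2}$) and $I^-$
(with $r=q^{-1/2}$).

Independence. If elements $J_i$ satisfy the cubic relations and commute with a $q$-oscillator action
$k_i,f_i,e_i$ on one more row of variables, then the $J_ik_i+f_i+e_i$ satisfy them too
(`CoprodData.serre_coproduct`); this is the coideal coproduct. Starting from $J_i=0$ and adding one
row at a time gives an action on a space whose basis consists of formal Laurent monomials in
variables $x_{kj}$. In the grading by height, $f_i$ raises by one, $k_i$ preserves and $e_i$ lowers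
by one, so to leading order $J_i$ is its $f$-part (`sameLead_actJ_actF`). With operators acting from
the right, the leftmost factor of an ordered monomial hits the vacuum first, and rows are filled in
increasing order. In that situation $I_{kl}$ multiplies, to leading order, by $x_{kl}/x_{kk}$
(`rootVec_actF`). Hence different ordered monomials send the vacuum to vectors with different
leading Laurent monomials.

Spanning. Let $A_k$ be the subalgebra generated by the generators of the rows before $k$, and $V_k$
the span of the $I_{kl}$ with $l<k$. The relations yield $V_kA_k\subseteq A_kV_k$
(`letterSpan_mul_adjoin_le`), and for $x<y<k$ the bracket of $I_{ky}$ with $I_{kx}$ is $I_{yx}\in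
A_k$ (`qBracket_rootVec_rootVec`). So words in the letters of row $k$ can be sorted modulo shorter
words with coefficients in $A_k$ (`adjoin_le_mul_span_sorted`), and induction on $k$ finishes. The
condition $[2]\ne0$ enters only through `commute_qBracket_qBracket`, where one divides by it. -/

/-- The quantum integer `[a] = (q ^ a - q ^ (-a)) / (q - q⁻¹)`, with its limit at `q = ±1`. -/
def qInt (q : ℂ) (a : ℤ) : ℂ :=
  if q ^ 2 = 1 then a * q ^ (a - 1) else (q ^ a - (q ^ a)⁻¹) / (q - q⁻¹)

/-! ### Quantum integer identities, valid also at $q=\pm1$ -/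

section qInt

variable {q : ℂ}

theorem sub_inv_ne_zero_of_sq_ne_one (hq : q ≠ 0) (h : q ^ 2 ≠ 1) : q - q⁻¹ ≠ 0 := by
  intro h'
  apply h
  field_simp at h'
  linear_combination h'

@[simp] theorem qInt_zero : qInt q 0 = 0 := by simp [qInt]

theorem qInt_one (hq : q ≠ 0) : qInt q 1 = 1 := by
  unfold qInt
  split_ifs with h
  · simp
  · simpa using div_self (sub_inv_ne_zero_of_sq_ne_one hq h)

theorem qInt_add_one (hq : q ≠ 0) (a : ℤ) :
    qInt q (a + 1) = q * qInt q a + (q ^ a)⁻¹ := by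
  unfold qInt
  have ha : q ^ a ≠ 0 := zpow_ne_zero _ hq
  split_ifs with h
  · have h2 : (q ^ a) ^ 2 = 1 := by
      rw [← zpow_natCast, ← zpow_mul, mul_comm, zpow_mul]
      simp [h]
    have h3 : (q ^ a)⁻¹ = q ^ a := by field_simp; exact h2.symm
    rw [h3, add_sub_cancel_right, zpow_sub_one₀ hq]
    push_cast
    field_simp
  · have := sub_inv_ne_zero_of_sq_ne_one hq h
    have h1 : q ^ 2 - 1 ≠ 0 := sub_ne_zero.2 h
    rw [zpow_add_one₀ hq]
    field_simp
    ring

theorem qInt_sub_one (hq : q ≠ 0) (a : ℤ) :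
    qInt q (a - 1) = q⁻¹ * qInt q a - (q ^ a)⁻¹ := by
  have h := qInt_add_one hq (a - 1)
  have ha : q ^ a ≠ 0 := zpow_ne_zero _ hq
  rw [sub_add_cancel, zpow_sub_one₀ hq] at h
  rw [h]
  field_simp
  ring

theorem sub_inv_mul_qInt (hq : q ≠ 0) (a : ℤ) :
    (q - q⁻¹) * qInt q a = q ^ a - (q ^ a)⁻¹ := by
  unfold qInt
  have ha : q ^ a ≠ 0 := zpow_ne_zero _ hq
  split_ifs with h
  · have h2 : (q ^ a) ^ 2 = 1 := by
      rw [← zpow_natCast, ← zpow_mul, mul_comm, zpow_mul]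
      simp [h]
    have h3 : (q ^ a)⁻¹ = q ^ a := by field_simp; exact h2.symm
    have h4 : q⁻¹ = q := by field_simp; exact h.symm
    rw [h3, h4]; ring
  · have := sub_inv_ne_zero_of_sq_ne_one hq h
    field_simp

theorem qInt_add_one_add_qInt_sub_one (hq : q ≠ 0) (a : ℤ) :
    qInt q (a + 1) + qInt q (a - 1) = (q + q⁻¹) * qInt q a := by
  rw [qInt_add_one hq, qInt_sub_one hq]; ring

/-- This is the scalar form of the relation between $e_i$ and $f_i$ in the oscillator
representation. -/
theorem qInt_mul_sub_mul (hq : q ≠ 0) (a b : ℤ) :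
    qInt q b * qInt q (a + 1) - qInt q a * qInt q (b + 1) = qInt q (b - a) := by
  have ha : q ^ a ≠ 0 := zpow_ne_zero _ hq
  have hb : q ^ b ≠ 0 := zpow_ne_zero _ hq
  rw [qInt_add_one hq, qInt_add_one hq]
  unfold qInt
  split_ifs with h
  · have h2 : (q ^ a) ^ 2 = 1 := by
      rw [← zpow_natCast, ← zpow_mul, mul_comm, zpow_mul]
      simp [h]
    have h3 : (q ^ a)⁻¹ = q ^ a := by field_simp; exact h2.symm
    have h2 : (q ^ b) ^ 2 = 1 := by
      rw [← zpow_natCast, ← zpow_mul, mul_comm, zpow_mul]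
      simp [h]
    have h4 : (q ^ b)⁻¹ = q ^ b := by field_simp; exact h2.symm
    rw [zpow_sub_one₀ hq, zpow_sub_one₀ hq, zpow_sub_one₀ hq, zpow_sub₀ hq, div_eq_mul_inv,
      h3, h4]
    push_cast
    ring
  · have := sub_inv_ne_zero_of_sq_ne_one hq h
    have h1 : q ^ 2 - 1 ≠ 0 := sub_ne_zero.2 h
    rw [zpow_sub₀ hq]
    field_simp
    ring

end qInt

/-! ### The cubic relation and the coideal coproduct -/

/-- The cubic expression `x² y - c x y x + y x²`. -/
def serre {B : Type*} [Ring B] [Algebra ℂ B] (c : ℂ) (x y : B) : B :=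
  x ^ 2 * y - c • (x * y * x) + y * x ^ 2

/-- The polarization of `serre` in its first variable. -/
def serrePolar {B : Type*} [Ring B] [Algebra ℂ B] (c : ℂ) (x z y : B) : B :=
  (x * z + z * x) * y - c • (x * y * z + z * y * x) + y * (x * z + z * x)

section Coproduct

variable {B : Type*} [Ring B] [Algebra ℂ B]

theorem serre_zero_zero (c : ℂ) : serre c (0 : B) 0 = -0 := by simp [serre]

theorem serre_add_left (c : ℂ) (x z y : B) :
    serre c (x + z) y = serre c x y + serre c z y + serrePolar c x z y := by
  simp only [serre, serrePolar, pow_two, mul_add, add_mul, smul_add, mul_assoc]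
  abel

theorem serre_add_right (c : ℂ) (x y z : B) :
    serre c x (y + z) = serre c x y + serre c x z := by
  simp only [serre, pow_two, mul_add, add_mul, smul_add, mul_assoc]
  abel

theorem serrePolar_add_left (c : ℂ) (x x' z y : B) :
    serrePolar c (x + x') z y = serrePolar c x z y + serrePolar c x' z y := by
  simp only [serrePolar, mul_add, add_mul, smul_add, mul_assoc]
  abel

theorem mul_mul_of_eq_smul {x y z : B} {α : ℂ} (h : x * y = α • z) (w : B) :
    x * (y * w) = α • (z * w) := by
  rw [← mul_assoc, h, smul_mul_assoc]

theorem serre_eq_zero_of_mul_eq_smul {q : ℂ} (hq : q ≠ 0) {x y : B} (h : x * y = q • (y * x)) :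
    serre (q + q⁻¹) x y = 0 := by
  have h' := mul_mul_of_eq_smul h
  simp only [serre, pow_two, mul_assoc, h, h', mul_smul_comm,
    smul_mul_assoc, smul_smul]
  match_scalars <;> field_simp <;> ring

theorem serre_eq_zero_of_mul_eq_inv_smul {q : ℂ} (hq : q ≠ 0) {x y : B}
    (h : x * y = q⁻¹ • (y * x)) : serre (q + q⁻¹) x y = 0 := by
  have := serre_eq_zero_of_mul_eq_smul (inv_ne_zero hq) h
  rwa [inv_inv, add_comm] at this

theorem serrePolar_eq_zero_of_mul_eq_smul {q : ℂ} (hq : q ≠ 0) {x z y : B}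
    (h : x * y = q • (y * x)) (h1 : z * y = q • (y * z)) :
    serrePolar (q + q⁻¹) x z y = 0 := by
  have h' := mul_mul_of_eq_smul h
  have h1' := mul_mul_of_eq_smul h1
  simp only [serrePolar, add_mul, mul_add, mul_assoc, h, h', h1, h1', mul_smul_comm,
    smul_mul_assoc, smul_smul]
  match_scalars <;> field_simp <;> ring

/-- If `a` `q`-commutes with `x` and `y` as a group-like element does with `f_i` and `f_j`, then
the polarized relation holds. -/
theorem serrePolar_eq_zero_of_grouplike {q : ℂ} (hq : q ≠ 0) {a x y : B}
    (hx : a * x = (q⁻¹ ^ 2) • (x * a)) (hy : a * y = q • (y * a)) :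
    serrePolar (q + q⁻¹) a x y = 0 := by
  simp only [serrePolar, add_mul, mul_add, mul_assoc, hx, hy, mul_smul_comm,
    smul_mul_assoc, smul_smul]
  match_scalars <;> field_simp <;> ring

theorem serrePolar_eq_zero_of_weight {q : ℂ} (hq : q ≠ 0) {x a y : B}
    (hx : a * x = (q⁻¹ ^ 2) • (x * a)) (hy : y * x = q • (x * y)) :
    serrePolar (q + q⁻¹) a x y = 0 := by
  have hx' := mul_mul_of_eq_smul hx
  have hy' := mul_mul_of_eq_smul hy
  simp only [serrePolar, add_mul, mul_add, mul_assoc, hx, hx', hy, hy', mul_smul_comm,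
    smul_mul_assoc, smul_smul]
  match_scalars <;> field_simp <;> ring

/-- The relations between the operators attached to two neighbouring simple roots `i` and `j`
that make the elements `J_i k_i + f_i + e_i` satisfy the cubic relations whenever the `J_i` do. -/
structure CoprodData (q : ℂ) (ki fi ei di kj fj ej : B) : Prop where
  kk : ki * kj = kj * ki
  kfi : ki * fi = (q⁻¹ ^ 2) • (fi * ki)
  kei : ki * ei = (q ^ 2) • (ei * ki)
  kfj : ki * fj = q • (fj * ki)
  kej : ki * ej = q⁻¹ • (ej * ki)
  kjf : kj * fi = q • (fi * kj)
  kje : kj * ei = q⁻¹ • (ei * kj)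
  ejf : ej * fi = q • (fi * ej)
  eif : ei * fj = q • (fj * ei)
  fe : fi * ei = (q ^ 2) • (ei * fi) - di
  df : di * fj = (q ^ 2) • (fj * di) - (q ^ 2) • fj
  de : di * ej = (q⁻¹ ^ 2) • (ej * di) + ej
  dk : (1 - q⁻¹ ^ 2) • di = 1 - ki * ki
  sf : serre (q + q⁻¹) fi fj = 0
  se : serre (q + q⁻¹) ei ej = 0

variable {q : ℂ} {ki fi ei di kj fj ej : B}

theorem CoprodData.serrePolar_f (hq : q ≠ 0) (H : CoprodData q ki fi ei di kj fj ej) :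
    serrePolar (q + q⁻¹) fi ei fj = -fj := by
  have h1 : ∀ w, fi * (ei * w) = (q ^ 2) • (ei * (fi * w)) - di * w := fun w => by
    rw [← mul_assoc, H.fe, sub_mul, smul_mul_assoc, mul_assoc]
  have h2 : fj * ei = q⁻¹ • (ei * fj) := by rw [H.eif, smul_smul, inv_mul_cancel₀ hq, one_smul]
  have h2' := mul_mul_of_eq_smul h2
  simp only [serrePolar, add_mul, mul_add, mul_assoc, h1, h2, h2', H.fe, H.df, mul_smul_comm,
    smul_mul_assoc, smul_smul, mul_sub, sub_mul, smul_sub]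
  match_scalars <;> field_simp <;> ring

theorem CoprodData.serrePolar_e (hq : q ≠ 0) (H : CoprodData q ki fi ei di kj fj ej) :
    serrePolar (q + q⁻¹) fi ei ej = -ej := by
  have h2 : fi * ej = q⁻¹ • (ej * fi) := by rw [H.ejf, smul_smul, inv_mul_cancel₀ hq, one_smul]
  simp only [serrePolar, add_mul, mul_add, mul_assoc, h2, H.fe, H.de, mul_smul_comm,
    smul_mul_assoc, smul_smul, mul_sub, sub_mul, smul_sub, smul_add]
  match_scalars <;> field_simp <;> ring

theorem CoprodData.serrePolar_b (hq : q ≠ 0) (H : CoprodData q ki fi ei di kj fj ej) {b : B}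
    (hf : b * fi = q • (fi * b)) (he : b * ei = q⁻¹ • (ei * b)) :
    serrePolar (q + q⁻¹) fi ei b = -((1 - ki * ki) * b) := by
  have h1 := mul_mul_of_eq_smul hf
  have h2 := mul_mul_of_eq_smul he
  have h3 : ∀ w, fi * (ei * w) = (q ^ 2) • (ei * (fi * w)) - di * w := fun w => by
    rw [← mul_assoc, H.fe, sub_mul, smul_mul_assoc, mul_assoc]
  rw [← H.dk]
  simp only [serrePolar, add_mul, mul_add, mul_assoc, hf, he, h1, h2, h3, mul_smul_comm,
    smul_smul, smul_mul_assoc, smul_sub]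
  match_scalars <;> field_simp <;> ring

/-- Write $A=J_ik_i$ and $B=J_jk_j$ and expand: the expression is quadratic in its first argument
and linear in its second. Nearly every term vanishes by $q$-commutation or by the Serre relations of
the row. The survivors are $-k_i^2B$ from $(A,A,B)$ and, from the polarization in $f_i,e_i$, the
terms $-(1-k_i^2)B$, $-f_j$ and $-e_j$; they add up to the claim. -/
theorem CoprodData.serre_coproduct (hq : q ≠ 0) (H : CoprodData q ki fi ei di kj fj ej)
    {ji jj : B} (hJ : serre (q + q⁻¹) ji jj = -jj)
    (hji : ∀ x ∈ ({ki, fi, ei, kj, fj, ej} : Set B), Commute ji x)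
    (hjj : ∀ x ∈ ({ki, fi, ei, kj, fj, ej} : Set B), Commute jj x) :
    serre (q + q⁻¹) (ji * ki + fi + ei) (jj * kj + fj + ej) = -(jj * kj + fj + ej) := by
  have hq' := inv_ne_zero hq
  have lift : ∀ {J k x : B} {α : ℂ}, Commute J x → k * x = α • (x * k) →
      (J * k) * x = α • (x * (J * k)) := by
    intro J k x α h1 h2
    rw [mul_assoc, h2, mul_smul_comm, ← mul_assoc, h1.eq, mul_assoc]
  have Af := lift (hji fi (by simp)) H.kfi
  have Ae := lift (hji ei (by simp)) H.kei
  have Afj := lift (hji fj (by simp)) H.kfj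
  have Aej := lift (hji ej (by simp)) H.kej
  have Bf := lift (hjj fi (by simp)) H.kjf
  have Be := lift (hjj ei (by simp)) H.kje
  have flip : ∀ {x y : B} {α : ℂ}, α ≠ 0 → x * y = α • (y * x) → y * x = α⁻¹ • (x * y) := by
    intro x y α hα h
    rw [h, smul_smul, inv_mul_cancel₀ hα, one_smul]
  -- The relations involving $e$ have the shape of those for $f$ with $q^{-1}$ in place of $q$, and
  -- the coefficient is symmetric.
  have hc : q + q⁻¹ = q⁻¹ + q⁻¹⁻¹ := by rw [inv_inv, add_comm]
  have hAB : serre (q + q⁻¹) (ji * ki) (jj * kj) = -(ki * ki * (jj * kj)) := by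
    have e1 := (hji ki (by simp)).symm.eq
    have e2 := (hji kj (by simp)).symm.eq
    have e3 := (hjj ki (by simp)).symm.eq
    have e4 := (hjj kj (by simp)).symm.eq
    have r : ∀ {x y : B}, x * y = y * x → ∀ w, x * (y * w) = y * (x * w) := by
      intro x y h w
      rw [← mul_assoc, h, mul_assoc]
    have : serre (q + q⁻¹) (ji * ki) (jj * kj) = serre (q + q⁻¹) ji jj * (ki * (ki * kj)) := by
      simp only [serre, pow_two, mul_assoc, add_mul, sub_mul, smul_mul_assoc,
        r e1, r e2, r e3, H.kk.symm, r H.kk.symm]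
    rw [this, hJ]
    simp only [mul_assoc, r e3, neg_mul]
  simp only [serre_add_left, serre_add_right, serrePolar_add_left]
  rw [hAB, H.sf, H.se, H.serrePolar_f hq, H.serrePolar_e hq, H.serrePolar_b hq Bf Be,
    serre_eq_zero_of_mul_eq_smul hq Afj, serre_eq_zero_of_mul_eq_inv_smul hq Aej,
    serre_eq_zero_of_mul_eq_inv_smul hq (flip hq Bf),
    serre_eq_zero_of_mul_eq_inv_smul hq (flip hq H.ejf),
    serre_eq_zero_of_mul_eq_smul hq H.eif,
    serrePolar_eq_zero_of_grouplike hq Af Afj,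
    serrePolar_eq_zero_of_weight hq Af Bf,
    serrePolar_eq_zero_of_mul_eq_smul hq Afj H.eif]
  have eB : serre (q + q⁻¹) ei (jj * kj) = 0 := by
    apply serre_eq_zero_of_mul_eq_smul hq
    simpa using flip hq' Be
  have Afe : serrePolar (q + q⁻¹) (ji * ki) fi ej = 0 := by
    rw [hc]
    exact serrePolar_eq_zero_of_mul_eq_smul hq' Aej (flip hq H.ejf)
  have Aee : serrePolar (q + q⁻¹) (ji * ki) ei ej = 0 := by
    rw [hc]
    refine serrePolar_eq_zero_of_grouplike hq' ?_ Aej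
    rwa [inv_inv]
  have AeB : serrePolar (q + q⁻¹) (ji * ki) ei (jj * kj) = 0 := by
    rw [hc]
    refine serrePolar_eq_zero_of_weight hq' ?_ Be
    rwa [inv_inv]
  rw [eB, Afe, Aee, AeB, sub_mul, one_mul]
  abel

end Coproduct

/-! ### Weighted shift operators on Fock space -/

/-- The vector space with basis `ℕ → ℕ → ℤ`; a basis vector records the exponent of a variable
`x_{kj}` for each row `k` and column `j`. -/
abbrev Fock : Type := (ℕ → ℕ → ℤ) →₀ ℂ

/-- The weighted shift sending the basis vector `a` to `w a` times the basis vector `a + δ`. -/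
def shiftOp (w : (ℕ → ℕ → ℤ) → ℂ) (δ : ℕ → ℕ → ℤ) : Module.End ℂ Fock :=
  Finsupp.linearCombination ℂ fun a => Finsupp.single (a + δ) (w a)

/-- A weighted shift that only sees and only changes row `k`. -/
def rowOp (k : ℕ) (w : (ℕ → ℤ) → ℂ) (δ : ℕ → ℤ) : Module.End ℂ Fock :=
  shiftOp (fun a => w (a k)) (Pi.single k δ)

section RowOp

theorem shiftOp_single (w : (ℕ → ℕ → ℤ) → ℂ) (δ a : ℕ → ℕ → ℤ) (c : ℂ) :
    shiftOp w δ (Finsupp.single a c) = Finsupp.single (a + δ) (c * w a) := by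
  simp [shiftOp]

theorem end_ext {S T : Module.End ℂ Fock}
    (h : ∀ a, S (Finsupp.single a 1) = T (Finsupp.single a 1)) : S = T :=
  Finsupp.lhom_ext' fun a => LinearMap.ext_ring (h a)

theorem shiftOp_mul (w w' : (ℕ → ℕ → ℤ) → ℂ) (δ δ' : ℕ → ℕ → ℤ) :
    shiftOp w δ * shiftOp w' δ' = shiftOp (fun a => w' a * w (a + δ')) (δ' + δ) := by
  refine end_ext fun a => ?_
  simp [shiftOp_single, add_assoc]

theorem rowOp_single (k : ℕ) (w : (ℕ → ℤ) → ℂ) (δ : ℕ → ℤ) (a : ℕ → ℕ → ℤ) (c : ℂ) :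
    rowOp k w δ (Finsupp.single a c) = Finsupp.single (a + Pi.single k δ) (c * w (a k)) :=
  shiftOp_single ..

theorem rowOp_mul (k : ℕ) (w w' : (ℕ → ℤ) → ℂ) (δ δ' : ℕ → ℤ) :
    rowOp k w δ * rowOp k w' δ' = rowOp k (fun x => w' x * w (x + δ')) (δ' + δ) := by
  simp [rowOp, shiftOp_mul, Pi.single_add]

theorem rowOp_commute {k l : ℕ} (h : k ≠ l) (w w' : (ℕ → ℤ) → ℂ) (δ δ' : ℕ → ℤ) :
    Commute (rowOp k w δ) (rowOp l w' δ') := by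
  refine end_ext fun a => ?_
  simp only [Module.End.mul_apply, rowOp_single, Pi.add_apply, Pi.single_eq_of_ne h,
    Pi.single_eq_of_ne h.symm, add_zero, one_mul]
  rw [add_right_comm, mul_comm]

theorem smul_rowOp (c : ℂ) (k : ℕ) (w : (ℕ → ℤ) → ℂ) (δ : ℕ → ℤ) :
    c • rowOp k w δ = rowOp k (fun x => c * w x) δ := by
  refine end_ext fun a => ?_
  simp [rowOp_single]

theorem rowOp_add (k : ℕ) (w w' : (ℕ → ℤ) → ℂ) (δ : ℕ → ℤ) :
    rowOp k w δ + rowOp k w' δ = rowOp k (fun x => w x + w' x) δ := by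
  refine end_ext fun a => ?_
  simp [rowOp_single, Finsupp.single_add]

theorem rowOp_sub (k : ℕ) (w w' : (ℕ → ℤ) → ℂ) (δ : ℕ → ℤ) :
    rowOp k w δ - rowOp k w' δ = rowOp k (fun x => w x - w' x) δ := by
  refine end_ext fun a => ?_
  simp [rowOp_single, Finsupp.single_sub]

theorem one_eq_rowOp (k : ℕ) : (1 : Module.End ℂ Fock) = rowOp k (fun _ => 1) 0 := by
  refine end_ext fun a => ?_
  simp [rowOp_single]

theorem rowOp_zero (k : ℕ) (δ : ℕ → ℤ) : rowOp k (fun _ => 0) δ = 0 := by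
  refine end_ext fun a => ?_
  simp [rowOp_single]

/-- Turns a cubic relation between weighted shifts into a scalar identity between their weights. -/
theorem serre_rowOp (c : ℂ) (k : ℕ) (w w' : (ℕ → ℤ) → ℂ) (δ δ' : ℕ → ℤ) :
    serre c (rowOp k w δ) (rowOp k w' δ') =
      rowOp k (fun x => w' x * w (x + δ') * w (x + δ' + δ)
        - c * (w x * w' (x + δ) * w (x + δ + δ'))
        + w x * w (x + δ) * w' (x + δ + δ)) (δ + δ + δ') := by
  have e1 : rowOp k w δ ^ 2 * rowOp k w' δ' =
      rowOp k (fun x => w' x * w (x + δ') * w (x + δ' + δ)) (δ + δ + δ') := by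
    rw [pow_two, mul_assoc, rowOp_mul, rowOp_mul]
    congr 1
    · funext x; rw [add_assoc]
    · abel
  have e2 : rowOp k w δ * rowOp k w' δ' * rowOp k w δ =
      rowOp k (fun x => w x * w' (x + δ) * w (x + δ + δ')) (δ + δ + δ') := by
    rw [mul_assoc, rowOp_mul, rowOp_mul]
    congr 1
    · funext x; rw [add_assoc]
    · abel
  have e3 : rowOp k w' δ' * rowOp k w δ ^ 2 =
      rowOp k (fun x => w x * w (x + δ) * w' (x + δ + δ)) (δ + δ + δ') := by
    rw [pow_two, rowOp_mul, rowOp_mul]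
    congr 1
    · funext x; rw [add_assoc]
  rw [serre, e1, e2, e3, smul_rowOp, rowOp_sub, rowOp_add]

end RowOp

/-! ### The q-oscillator representation on one row of variables -/

/-- The shift of exponents replacing one `x_{i+1}` by one `x_i`. -/
def lower (i : ℕ) : ℕ → ℤ := Pi.single i 1 - Pi.single (i + 1) 1

theorem lower_apply (i j : ℕ) :
    lower i j = (if j = i then 1 else 0) - (if j = i + 1 then 1 else 0) := by
  simp [lower, Pi.single_apply]

variable (r : ℂ)

/-- The coefficient with which an exponent in column `j` of row `k` is lowered. -/
def downCoeff (k j : ℕ) (a : ℤ) : ℂ := if j = k then -r⁻¹ else qInt (r ^ 2) a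

/-- The coefficient with which an exponent in column `j` of row `k` is raised. -/
def upCoeff (k j : ℕ) (a : ℤ) : ℂ := if j = k then -r * qInt (r ^ 2) (a + 1) else 1

/-- The group-like operator of row `k`. -/
def rowK (k i : ℕ) : Module.End ℂ Fock :=
  rowOp k (fun x => (r ^ 2) ^ (x (i + 1) - x i)) 0

/-- The operator of row `k` replacing `x_{i+1}` by `x_i`. -/
def rowF (k i : ℕ) : Module.End ℂ Fock :=
  rowOp k (fun x => -r * downCoeff r k (i + 1) (x (i + 1)) * upCoeff r k i (x i)) (lower i)

/-- The operator of row `k` replacing `x_i` by `x_{i+1}`. -/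
def rowE (k i : ℕ) : Module.End ℂ Fock :=
  rowOp k (fun x => r * downCoeff r k i (x i) * upCoeff r k (i + 1) (x (i + 1)) *
    (r ^ 2) ^ (x (i + 1) - x i)) (-lower i)

/-- The `q`-commutator of `rowE` and `rowF`. -/
def rowD (k i : ℕ) : Module.End ℂ Fock :=
  rowOp k (fun x => -(r ^ 2) * (r ^ 2) ^ (x (i + 1) - x i) *
    qInt (r ^ 2) (x (i + 1) - x i)) 0

section Relations

variable {r}

/-- The relations depend only on this product, so the diagonal column may be normalized differently
from the others. There lowering has a nonzero constant coefficient, which lets negative powers of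
$x_{kk}$ be created from the vacuum; in the other columns lowering kills exponent zero. -/
theorem upCoeff_mul_downCoeff (hr : r ≠ 0) (k j : ℕ) (a : ℤ) :
    upCoeff r k j (a - 1) * downCoeff r k j a = qInt (r ^ 2) a := by
  unfold upCoeff downCoeff
  split_ifs
  · rw [sub_add_cancel]
    field_simp
  · simp

theorem upCoeff_mul_downCoeff_add_one (hr : r ≠ 0) (k j : ℕ) (a : ℤ) :
    upCoeff r k j a * downCoeff r k j (a + 1) = qInt (r ^ 2) (a + 1) := by
  simpa using upCoeff_mul_downCoeff hr k j (a + 1)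

theorem rowOp_congr {k : ℕ} {w w' : (ℕ → ℤ) → ℂ} {δ δ' : ℕ → ℤ} (hw : ∀ x, w x = w' x)
    (hδ : δ = δ') : rowOp k w δ = rowOp k w' δ' := by
  rw [hδ, funext hw]

@[simp] theorem lower_self (i : ℕ) : lower i i = 1 := by simp [lower_apply]

@[simp] theorem lower_succ (i : ℕ) : lower i (i + 1) = -1 := by simp [lower_apply]

@[simp] theorem lower_succ_succ (i : ℕ) : lower i (i + 1 + 1) = 0 := by
  rw [lower_apply, if_neg (by omega), if_neg (by omega), sub_zero]

@[simp] theorem lower_succ_left (i : ℕ) : lower (i + 1) i = 0 := by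
  rw [lower_apply, if_neg (by omega), if_neg (by omega), sub_zero]

theorem rowK_comm (k i j : ℕ) : rowK r k i * rowK r k j = rowK r k j * rowK r k i := by
  unfold rowK
  rw [rowOp_mul, rowOp_mul]
  exact rowOp_congr (fun x => by simp [mul_comm]) rfl

theorem rowK_mul_rowF (hr : r ≠ 0) (k i : ℕ) :
    rowK r k i * rowF r k i = ((r ^ 2)⁻¹ ^ 2) • (rowF r k i * rowK r k i) := by
  have hq : r ^ 2 ≠ 0 := pow_ne_zero 2 hr
  unfold rowK rowF
  rw [rowOp_mul, rowOp_mul, smul_rowOp]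
  refine rowOp_congr (fun x => ?_) (by abel)
  simp [zpow_sub₀ hq, zpow_add₀ hq, ← sub_eq_add_neg]

  field_simp

theorem rowK_mul_rowE (hr : r ≠ 0) (k i : ℕ) :
    rowK r k i * rowE r k i = ((r ^ 2) ^ 2) • (rowE r k i * rowK r k i) := by
  have hq : r ^ 2 ≠ 0 := pow_ne_zero 2 hr
  unfold rowK rowE
  rw [rowOp_mul, rowOp_mul, smul_rowOp]
  refine rowOp_congr (fun x => ?_) (by abel)
  simp [zpow_sub₀ hq, zpow_add₀ hq, ← sub_eq_add_neg]

  field_simp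

theorem rowK_mul_rowF_succ (hr : r ≠ 0) (k i : ℕ) :
    rowK r k i * rowF r k (i + 1) = (r ^ 2) • (rowF r k (i + 1) * rowK r k i) := by
  have hq : r ^ 2 ≠ 0 := pow_ne_zero 2 hr
  unfold rowK rowF
  rw [rowOp_mul, rowOp_mul, smul_rowOp]
  refine rowOp_congr (fun x => ?_) (by abel)
  simp [zpow_sub₀ hq, zpow_add₀ hq]

  field_simp

theorem rowK_mul_rowE_succ (hr : r ≠ 0) (k i : ℕ) :
    rowK r k i * rowE r k (i + 1) = (r ^ 2)⁻¹ • (rowE r k (i + 1) * rowK r k i) := by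
  have hq : r ^ 2 ≠ 0 := pow_ne_zero 2 hr
  unfold rowK rowE
  rw [rowOp_mul, rowOp_mul, smul_rowOp]
  refine rowOp_congr (fun x => ?_) (by abel)
  simp [zpow_sub₀ hq, ← sub_eq_add_neg]

  field_simp

theorem rowK_succ_mul_rowF (hr : r ≠ 0) (k i : ℕ) :
    rowK r k (i + 1) * rowF r k i = (r ^ 2) • (rowF r k i * rowK r k (i + 1)) := by
  have hq : r ^ 2 ≠ 0 := pow_ne_zero 2 hr
  unfold rowK rowF
  rw [rowOp_mul, rowOp_mul, smul_rowOp]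
  refine rowOp_congr (fun x => ?_) (by abel)
  simp [zpow_sub₀ hq, ← sub_eq_add_neg]

  field_simp

theorem rowK_succ_mul_rowE (hr : r ≠ 0) (k i : ℕ) :
    rowK r k (i + 1) * rowE r k i = (r ^ 2)⁻¹ • (rowE r k i * rowK r k (i + 1)) := by
  have hq : r ^ 2 ≠ 0 := pow_ne_zero 2 hr
  unfold rowK rowE
  rw [rowOp_mul, rowOp_mul, smul_rowOp]
  refine rowOp_congr (fun x => ?_) (by abel)
  simp [zpow_sub₀ hq, zpow_add₀ hq]

  field_simp

theorem rowE_succ_mul_rowF (hr : r ≠ 0) (k i : ℕ) :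
    rowE r k (i + 1) * rowF r k i = (r ^ 2) • (rowF r k i * rowE r k (i + 1)) := by
  have hq : r ^ 2 ≠ 0 := pow_ne_zero 2 hr
  unfold rowE rowF
  rw [rowOp_mul, rowOp_mul, smul_rowOp]
  refine rowOp_congr (fun x => ?_) (by abel)
  simp [zpow_sub₀ hq, ← sub_eq_add_neg]

  field_simp

theorem rowE_mul_rowF_succ (hr : r ≠ 0) (k i : ℕ) :
    rowE r k i * rowF r k (i + 1) = (r ^ 2) • (rowF r k (i + 1) * rowE r k i) := by
  have hq : r ^ 2 ≠ 0 := pow_ne_zero 2 hr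
  unfold rowE rowF
  rw [rowOp_mul, rowOp_mul, smul_rowOp]
  refine rowOp_congr (fun x => ?_) (by abel)
  simp [zpow_sub₀ hq, zpow_add₀ hq]

  field_simp

/-- In each column only a product of raising and lowering coefficients occurs, so this is
$[b][a+1]-[a][b+1]=[b-a]$ for the exponents $a,b$ in columns $i,i+1$. -/
theorem rowF_mul_rowE (hr : r ≠ 0) (k i : ℕ) :
    rowF r k i * rowE r k i = ((r ^ 2) ^ 2) • (rowE r k i * rowF r k i) - rowD r k i := by
  have hq : r ^ 2 ≠ 0 := pow_ne_zero 2 hr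
  have ud := upCoeff_mul_downCoeff hr k
  have ud' := upCoeff_mul_downCoeff_add_one hr k
  unfold rowF rowE rowD
  rw [rowOp_mul, rowOp_mul, smul_rowOp, neg_add_cancel, add_neg_cancel, rowOp_sub]
  refine rowOp_congr (fun x => ?_) rfl
  have h1 := ud i (x i)
  have h2 := ud' i (x i)
  have h3 := ud (i + 1) (x (i + 1))
  have h4 := ud' (i + 1) (x (i + 1))
  have h5 := qInt_mul_sub_mul hq (x i) (x (i + 1))
  simp [← sub_eq_add_neg]
  rw [show x (i + 1) - 1 - (x i + 1) = x (i + 1) - x i - 1 - 1 by ring, zpow_sub_one₀ hq,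
    zpow_sub_one₀ hq, ← h5, ← h1, ← h2, ← h3, ← h4]
  field_simp
  ring

theorem rowD_mul_rowF_succ (hr : r ≠ 0) (k i : ℕ) :
    rowD r k i * rowF r k (i + 1) =
      ((r ^ 2) ^ 2) • (rowF r k (i + 1) * rowD r k i) - ((r ^ 2) ^ 2) • rowF r k (i + 1) := by
  have hq : r ^ 2 ≠ 0 := pow_ne_zero 2 hr
  unfold rowD rowF
  simp only [rowOp_mul, smul_rowOp, zero_add, add_zero, rowOp_sub]
  refine rowOp_congr (fun x => ?_) rfl
  simp
  have hz : (r ^ 2) ^ (x (i + 1) - x i) ≠ 0 := zpow_ne_zero _ hq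
  rw [show x (i + 1) + 1 - x i = x (i + 1) - x i + 1 by ring, zpow_add_one₀ hq,
    qInt_add_one hq]
  field_simp

theorem rowD_succ_mul_rowF (hr : r ≠ 0) (k i : ℕ) :
    rowD r k (i + 1) * rowF r k i =
      ((r ^ 2) ^ 2) • (rowF r k i * rowD r k (i + 1)) - ((r ^ 2) ^ 2) • rowF r k i := by
  have hq : r ^ 2 ≠ 0 := pow_ne_zero 2 hr
  unfold rowD rowF
  simp only [rowOp_mul, smul_rowOp, zero_add, add_zero, rowOp_sub]
  refine rowOp_congr (fun x => ?_) rfl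
  simp [← sub_eq_add_neg]
  have hz : (r ^ 2) ^ (x (i + 1 + 1) - x (i + 1)) ≠ 0 := zpow_ne_zero _ hq
  rw [show x (i + 1 + 1) - (x (i + 1) - 1) = x (i + 1 + 1) - x (i + 1) + 1 by ring, zpow_add_one₀ hq,
    qInt_add_one hq]
  field_simp

theorem rowD_mul_rowE_succ (hr : r ≠ 0) (k i : ℕ) :
    rowD r k i * rowE r k (i + 1) =
      ((r ^ 2)⁻¹ ^ 2) • (rowE r k (i + 1) * rowD r k i) + rowE r k (i + 1) := by
  have hq : r ^ 2 ≠ 0 := pow_ne_zero 2 hr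
  unfold rowD rowE
  simp only [rowOp_mul, smul_rowOp, zero_add, add_zero, rowOp_add]
  refine rowOp_congr (fun x => ?_) rfl
  simp [← sub_eq_add_neg]
  have hz : (r ^ 2) ^ (x (i + 1) - x i) ≠ 0 := zpow_ne_zero _ hq
  rw [show x (i + 1) - 1 - x i = x (i + 1) - x i - 1 by ring, zpow_sub_one₀ hq,
    qInt_sub_one hq]
  field_simp
  ring

theorem rowD_succ_mul_rowE (hr : r ≠ 0) (k i : ℕ) :
    rowD r k (i + 1) * rowE r k i =
      ((r ^ 2)⁻¹ ^ 2) • (rowE r k i * rowD r k (i + 1)) + rowE r k i := by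
  have hq : r ^ 2 ≠ 0 := pow_ne_zero 2 hr
  unfold rowD rowE
  simp only [rowOp_mul, smul_rowOp, zero_add, add_zero, rowOp_add]
  refine rowOp_congr (fun x => ?_) rfl
  simp
  have hz : (r ^ 2) ^ (x (i + 1 + 1) - x (i + 1)) ≠ 0 := zpow_ne_zero _ hq
  rw [show x (i + 1 + 1) - (x (i + 1) + 1) = x (i + 1 + 1) - x (i + 1) - 1 by ring, zpow_sub_one₀ hq,
    qInt_sub_one hq]
  field_simp
  ring

/-- For $q^2\ne1$ this determines `rowD`. For $q^2=1$ the left side vanishes, which is why `rowD` is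
a separate operator with its own commutation relations and not a quotient of $1-k_i^2$. -/
theorem smul_rowD (hr : r ≠ 0) (k i : ℕ) :
    (1 - (r ^ 2)⁻¹ ^ 2) • rowD r k i = 1 - rowK r k i * rowK r k i := by
  have hq : r ^ 2 ≠ 0 := pow_ne_zero 2 hr
  unfold rowD rowK
  rw [rowOp_mul, smul_rowOp, one_eq_rowOp k, zero_add, rowOp_sub]
  refine rowOp_congr (fun x => ?_) rfl
  have h := sub_inv_mul_qInt hq (x (i + 1) - x i)
  have hz : (r ^ 2) ^ (x (i + 1) - x i) ≠ 0 := zpow_ne_zero _ hq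
  simp only [add_zero]
  generalize (r ^ 2) ^ (x (i + 1) - x i) = z at *
  have h' : (1 - (r ^ 2)⁻¹ ^ 2) * (-r ^ 2) = -(r ^ 2 - (r ^ 2)⁻¹) := by field_simp
  rw [← mul_assoc, ← mul_assoc, h', mul_right_comm, neg_mul, h]
  field_simp
  ring

/-- The three terms differ only in the order of raising and lowering in the shared column $i+1$;
after removing the common factor the identity is $[a+1]-[2][a]+[a-1]=0$. The other three Serre
relations hold for the same reason, up to powers of $q$. -/
theorem serre_rowF (hr : r ≠ 0) (k i : ℕ) :
    serre (r ^ 2 + (r ^ 2)⁻¹) (rowF r k i) (rowF r k (i + 1)) = 0 := by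
  have hq : r ^ 2 ≠ 0 := pow_ne_zero 2 hr
  have ud := upCoeff_mul_downCoeff hr k
  have ud' := upCoeff_mul_downCoeff_add_one hr k
  unfold rowF
  rw [serre_rowOp, ← rowOp_zero k (lower i + lower i + lower (i + 1))]
  refine rowOp_congr (fun x => ?_) rfl
  simp [← sub_eq_add_neg]
  have h1 := ud' (i + 1) (x (i + 1))
  have h2 := ud (i + 1) (x (i + 1))
  have h3 := ud (i + 1) (x (i + 1) - 1)
  have h := qInt_add_one_add_qInt_sub_one hq (x (i + 1))
  linear_combination (-r ^ 3 * (downCoeff r k (i + 1 + 1) (x (i + 1 + 1)) * downCoeff r k (i + 1) (x (i + 1)) *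
    upCoeff r k i (x i) * upCoeff r k i (x i + 1))) *
    (h1 - (r ^ 2 + (r ^ 2)⁻¹) * h2 + h3 + h)

theorem serre_rowF_succ (hr : r ≠ 0) (k i : ℕ) :
    serre (r ^ 2 + (r ^ 2)⁻¹) (rowF r k (i + 1)) (rowF r k i) = 0 := by
  have hq : r ^ 2 ≠ 0 := pow_ne_zero 2 hr
  have ud := upCoeff_mul_downCoeff hr k
  have ud' := upCoeff_mul_downCoeff_add_one hr k
  unfold rowF
  rw [serre_rowOp, ← rowOp_zero k (lower (i + 1) + lower (i + 1) + lower i)]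
  refine rowOp_congr (fun x => ?_) rfl
  simp [← sub_eq_add_neg]
  have h1 := ud (i + 1) (x (i + 1))
  have h2 := ud' (i + 1) (x (i + 1))
  have h3 := ud' (i + 1) (x (i + 1) + 1)
  have h := qInt_add_one_add_qInt_sub_one hq (x (i + 1) + 1)
  rw [add_sub_cancel_right] at h
  linear_combination (-r ^ 3 * (downCoeff r k (i + 1 + 1) (x (i + 1 + 1)) * downCoeff r k (i + 1 + 1) (x (i + 1 + 1) - 1) *
    upCoeff r k i (x i) * upCoeff r k (i + 1) (x (i + 1)))) *
    (h1 - (r ^ 2 + (r ^ 2)⁻¹) * h2 + h3 + h)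

theorem serre_rowE (hr : r ≠ 0) (k i : ℕ) :
    serre (r ^ 2 + (r ^ 2)⁻¹) (rowE r k i) (rowE r k (i + 1)) = 0 := by
  have hq : r ^ 2 ≠ 0 := pow_ne_zero 2 hr
  have ud := upCoeff_mul_downCoeff hr k
  have ud' := upCoeff_mul_downCoeff_add_one hr k
  unfold rowE
  rw [serre_rowOp, ← rowOp_zero k (-lower i + -lower i + -lower (i + 1))]
  refine rowOp_congr (fun x => ?_) rfl
  simp [← sub_eq_add_neg]
  have h1 := ud (i + 1) (x (i + 1))
  have h2 := ud' (i + 1) (x (i + 1))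
  have h3 := ud' (i + 1) (x (i + 1) + 1)
  have h := qInt_add_one_add_qInt_sub_one hq (x (i + 1) + 1)
  rw [add_sub_cancel_right] at h
  have hz : ∀ a : ℤ, (r ^ 2) ^ a ≠ 0 := fun a => zpow_ne_zero a hq
  simp only [zpow_sub₀ hq, zpow_add₀ hq, zpow_one]
  have hz₂ := hz (x (i + 1 + 1))
  have hz₁ := hz (x (i + 1))
  have hz₀ := hz (x i)
  generalize (r ^ 2) ^ x (i + 1 + 1) = z₂, (r ^ 2) ^ x (i + 1) = z₁, (r ^ 2) ^ x i = z₀ at *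
  field_simp
  rw [mul_zero, mul_eq_zero]
  right
  linear_combination r ^ 2 * h1 - (r ^ 4 + 1) * h2 + r ^ 2 * h3 + r ^ 2 * h +
    qInt (r ^ 2) (x (i + 1) + 1) * mul_inv_cancel₀ hq

theorem serre_rowE_succ (hr : r ≠ 0) (k i : ℕ) :
    serre (r ^ 2 + (r ^ 2)⁻¹) (rowE r k (i + 1)) (rowE r k i) = 0 := by
  have hq : r ^ 2 ≠ 0 := pow_ne_zero 2 hr
  have ud := upCoeff_mul_downCoeff hr k
  have ud' := upCoeff_mul_downCoeff_add_one hr k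
  unfold rowE
  rw [serre_rowOp, ← rowOp_zero k (-lower (i + 1) + -lower (i + 1) + -lower i)]
  refine rowOp_congr (fun x => ?_) rfl
  simp [← sub_eq_add_neg]
  have h1 := ud' (i + 1) (x (i + 1))
  have h2 := ud (i + 1) (x (i + 1))
  have h3 := ud (i + 1) (x (i + 1) - 1)
  have h := qInt_add_one_add_qInt_sub_one hq (x (i + 1))
  have hz : ∀ a : ℤ, (r ^ 2) ^ a ≠ 0 := fun a => zpow_ne_zero a hq
  simp only [zpow_sub₀ hq, zpow_add₀ hq, zpow_one]
  have hz₂ := hz (x (i + 1 + 1))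
  have hz₁ := hz (x (i + 1))
  have hz₀ := hz (x i)
  generalize (r ^ 2) ^ x (i + 1 + 1) = z₂, (r ^ 2) ^ x (i + 1) = z₁, (r ^ 2) ^ x i = z₀ at *
  field_simp
  rw [mul_zero, mul_eq_zero]
  right
  linear_combination r ^ 2 * h1 - (r ^ 4 + 1) * h2 + r ^ 2 * h3 + r ^ 2 * h +
    qInt (r ^ 2) (x (i + 1)) * mul_inv_cancel₀ hq


theorem coprodData_succ (hr : r ≠ 0) (k i : ℕ) :
    CoprodData (r ^ 2) (rowK r k i) (rowF r k i) (rowE r k i) (rowD r k i)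
      (rowK r k (i + 1)) (rowF r k (i + 1)) (rowE r k (i + 1)) where
  kk := rowK_comm k i (i + 1)
  kfi := rowK_mul_rowF hr k i
  kei := rowK_mul_rowE hr k i
  kfj := rowK_mul_rowF_succ hr k i
  kej := rowK_mul_rowE_succ hr k i
  kjf := rowK_succ_mul_rowF hr k i
  kje := rowK_succ_mul_rowE hr k i
  ejf := rowE_succ_mul_rowF hr k i
  eif := rowE_mul_rowF_succ hr k i
  fe := rowF_mul_rowE hr k i
  df := rowD_mul_rowF_succ hr k i
  de := rowD_mul_rowE_succ hr k i
  dk := smul_rowD hr k i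
  sf := serre_rowF hr k i
  se := serre_rowE hr k i

theorem coprodData_pred (hr : r ≠ 0) (k i : ℕ) :
    CoprodData (r ^ 2) (rowK r k (i + 1)) (rowF r k (i + 1)) (rowE r k (i + 1))
      (rowD r k (i + 1)) (rowK r k i) (rowF r k i) (rowE r k i) where
  kk := rowK_comm k (i + 1) i
  kfi := rowK_mul_rowF hr k (i + 1)
  kei := rowK_mul_rowE hr k (i + 1)
  kfj := rowK_succ_mul_rowF hr k i
  kej := rowK_succ_mul_rowE hr k i
  kjf := rowK_mul_rowF_succ hr k i
  kje := rowK_mul_rowE_succ hr k i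
  ejf := rowE_mul_rowF_succ hr k i
  eif := rowE_succ_mul_rowF hr k i
  fe := rowF_mul_rowE hr k (i + 1)
  df := rowD_succ_mul_rowF hr k i
  de := rowD_succ_mul_rowE hr k i
  dk := smul_rowD hr k (i + 1)
  sf := serre_rowF_succ hr k i
  se := serre_rowE_succ hr k i

end Relations

/-! ### The action of the generators on Fock space -/

/-- The operator by which `I_{i+1,i}` acts on the first `N` rows. -/
def actJ : ℕ → ℕ → Module.End ℂ Fock
  | 0, _ => 0
  | N + 1, i => actJ N i * rowK r N i + rowF r N i + rowE r N i

/-- The part of `actJ` that raises the height. -/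
def actF : ℕ → ℕ → Module.End ℂ Fock
  | 0, _ => 0
  | N + 1, i => actF N i * rowK r N i + rowF r N i

section Action

variable {r}

theorem actJ_commute_rowOp {N k : ℕ} (h : N ≤ k) (i : ℕ) (w : (ℕ → ℤ) → ℂ) (δ : ℕ → ℤ) :
    Commute (actJ r N i) (rowOp k w δ) := by
  induction N with
  | zero => exact Commute.zero_left _
  | succ N ih =>
    have hne : N ≠ k := by omega
    exact (((ih (by omega)).mul_left (rowOp_commute hne ..)).add_left
      (rowOp_commute hne ..)).add_left (rowOp_commute hne ..)

theorem actF_commute_rowOp {N k : ℕ} (h : N ≤ k) (i : ℕ) (w : (ℕ → ℤ) → ℂ) (δ : ℕ → ℤ) :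
    Commute (actF r N i) (rowOp k w δ) := by
  induction N with
  | zero => exact Commute.zero_left _
  | succ N ih =>
    have hne : N ≠ k := by omega
    exact ((ih (by omega)).mul_left (rowOp_commute hne ..)).add_left (rowOp_commute hne ..)

theorem actJ_commute_row (N i j : ℕ) :
    ∀ x ∈ ({rowK r N i, rowF r N i, rowE r N i, rowK r N j, rowF r N j, rowE r N j} :
      Set (Module.End ℂ Fock)), ∀ l, Commute (actJ r N l) x := by
  rintro x (rfl | rfl | rfl | rfl | rfl | rfl) l <;> exact actJ_commute_rowOp le_rfl ..

/-- Induction on the number of rows by the coproduct. The base case is the zero action, admissible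
because the right-hand side of the relation is linear in the generator. -/
theorem serre_actJ_succ (hr : r ≠ 0) (N i : ℕ) :
    serre (r ^ 2 + (r ^ 2)⁻¹) (actJ r N i) (actJ r N (i + 1)) = -actJ r N (i + 1) := by
  induction N with
  | zero => exact serre_zero_zero _
  | succ N ih =>
    exact (coprodData_succ hr N i).serre_coproduct (pow_ne_zero 2 hr) ih
      (fun x hx => actJ_commute_row N i (i + 1) x hx _)
      (fun x hx => actJ_commute_row N i (i + 1) x hx _)

theorem serre_actJ_pred (hr : r ≠ 0) (N i : ℕ) :
    serre (r ^ 2 + (r ^ 2)⁻¹) (actJ r N (i + 1)) (actJ r N i) = -actJ r N i := by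
  induction N with
  | zero => exact serre_zero_zero _
  | succ N ih =>
    exact (coprodData_pred hr N i).serre_coproduct (pow_ne_zero 2 hr) ih
      (fun x hx => actJ_commute_row N (i + 1) i x hx _)
      (fun x hx => actJ_commute_row N (i + 1) i x hx _)

theorem rowOp_commute_of_shift {k : ℕ} {w w' : (ℕ → ℤ) → ℂ} {δ δ' : ℕ → ℤ}
    (h : ∀ x, w (x + δ') = w x) (h' : ∀ x, w' (x + δ) = w' x) :
    Commute (rowOp k w δ) (rowOp k w' δ') := by
  rw [Commute, SemiconjBy, rowOp_mul, rowOp_mul]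
  exact rowOp_congr (fun x => by rw [h, h', mul_comm]) (add_comm _ _)

theorem lower_eq_zero {i j : ℕ} (h1 : j ≠ i) (h2 : j ≠ i + 1) : lower i j = 0 := by
  simp [lower_apply, h1, h2]

/-- Within a row, the operators for $i$ see and change only columns $i,i+1$, which are disjoint from
$j,j+1$. -/
theorem actJ_commute {i j : ℕ} (h : i + 1 < j) (N : ℕ) :
    Commute (actJ r N i) (actJ r N j) := by
  have e1 : lower i j = 0 := lower_eq_zero (by omega) (by omega)
  have e2 : lower i (j + 1) = 0 := lower_eq_zero (by omega) (by omega)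
  have e3 : lower j i = 0 := lower_eq_zero (by omega) (by omega)
  have e4 : lower j (i + 1) = 0 := lower_eq_zero (by omega) (by omega)
  induction N with
  | zero => exact Commute.zero_left _
  | succ N ih =>
    have c : ∀ l w δ, Commute (actJ r N l) (rowOp N w δ) := fun l => actJ_commute_rowOp le_rfl l
    have s : ∀ {w w' : (ℕ → ℤ) → ℂ} {δ δ' : ℕ → ℤ}, (∀ x, w (x + δ') = w x) →
        (∀ x, w' (x + δ) = w' x) → Commute (rowOp N w δ) (rowOp N w' δ') := rowOp_commute_of_shift
    have hJ : Commute (actJ r N i) (actJ r (N + 1) j) :=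
      ((ih.mul_right (c ..)).add_right (c ..)).add_right (c ..)
    have hK : Commute (rowK r N i) (actJ r (N + 1) j) := by
      refine (Commute.add_right (Commute.mul_right (c ..).symm (s ?_ ?_)) (s ?_ ?_)).add_right
        (s ?_ ?_) <;> intro x <;> simp [e1, e2, e3, e4]
    have hF : Commute (rowF r N i) (actJ r (N + 1) j) := by
      refine (Commute.add_right (Commute.mul_right (c ..).symm (s ?_ ?_)) (s ?_ ?_)).add_right
        (s ?_ ?_) <;> intro x <;> simp [e1, e2, e3, e4]
    have hE : Commute (rowE r N i) (actJ r (N + 1) j) := by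
      refine (Commute.add_right (Commute.mul_right (c ..).symm (s ?_ ?_)) (s ?_ ?_)).add_right
        (s ?_ ?_) <;> intro x <;> simp [e1, e2, e3, e4]
    exact ((hJ.mul_left hK).add_left hF).add_left hE

end Action

/-! ### Root vectors and ordered monomials in an arbitrary algebra -/

section RootVectors

variable {B : Type*} [Ring B] [Algebra ℂ B] (r : ℂ)

/-- The element `I_{l+d+1,l}` built from a sequence `g` of generators by iterated brackets. -/
def rootVec (g : ℕ → B) : ℕ → ℕ → B
  | l, 0 => g l
  | l, d + 1 => qBracket r (g l) (rootVec g (l + 1) d)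

/-- The product of the `I_{kl} ^ m_l` for `l < t`, in increasing order of `l`. -/
def rowMonomial (g : ℕ → B) (k : ℕ) (m : ℕ → ℕ) (t : ℕ) : B :=
  ((List.range t).map fun l => rootVec r g l (k - l - 1) ^ m l).prod

/-- The ordered monomial in the `I_{kl}` with `l < k < n`. -/
def orderedMonomial (g : ℕ → B) (m : ℕ → ℕ → ℕ) (n : ℕ) : B :=
  ((List.range n).map fun k => rowMonomial r g k (m k) k).prod

variable {r}

theorem rowMonomial_succ (g : ℕ → B) (k : ℕ) (m : ℕ → ℕ) (t : ℕ) :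
    rowMonomial r g k m (t + 1) =
      rowMonomial r g k m t * rootVec r g t (k - t - 1) ^ m t := by
  simp [rowMonomial, List.range_succ]

theorem orderedMonomial_succ (g : ℕ → B) (m : ℕ → ℕ → ℕ) (n : ℕ) :
    orderedMonomial r g m (n + 1) =
      orderedMonomial r g m n * rowMonomial r g n (m n) n := by
  simp [orderedMonomial, List.range_succ]

theorem map_rootVec {C : Type*} [Ring C] [Algebra ℂ C] (φ : B →ₐ[ℂ] C) (g : ℕ → B) (l d : ℕ) :
    φ (rootVec r g l d) = rootVec r (fun i => φ (g i)) l d := by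
  induction d generalizing l with
  | zero => rfl
  | succ d ih => simp [rootVec, qBracket, ih]

theorem map_orderedMonomial {C : Type*} [Ring C] [Algebra ℂ C] (φ : B →ₐ[ℂ] C) (g : ℕ → B)
    (m : ℕ → ℕ → ℕ) (n : ℕ) :
    φ (orderedMonomial r g m n) = orderedMonomial r (fun i => φ (g i)) m n := by
  have h : ∀ k t, φ (rowMonomial r g k (m k) t) = rowMonomial r (fun i => φ (g i)) k (m k) t := by
    intro k t
    induction t with
    | zero => simp [rowMonomial]
    | succ t ih => rw [rowMonomial_succ, rowMonomial_succ, map_mul, ih, map_pow, map_rootVec]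
  induction n with
  | zero => simp [orderedMonomial]
  | succ n ih => rw [orderedMonomial_succ, orderedMonomial_succ, map_mul, ih, h]

theorem rootVec_congr {g g' : ℕ → B} {l d n : ℕ} (h : ∀ i, i + 1 < n → g i = g' i)
    (hl : l + d + 1 < n) : rootVec r g l d = rootVec r g' l d := by
  induction d generalizing l with
  | zero => exact h _ hl
  | succ d ih => rw [rootVec, rootVec, h _ (by omega), ih (by omega)]

theorem orderedMonomial_congr {g g' : ℕ → B} {n : ℕ} (h : ∀ i, i + 1 < n → g i = g' i)
    (m : ℕ → ℕ → ℕ) : orderedMonomial r g m n = orderedMonomial r g' m n := by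
  have h' : ∀ k t, k < n → t ≤ k → rowMonomial r g k (m k) t = rowMonomial r g' k (m k) t := by
    intro k t hk ht
    induction t with
    | zero => simp [rowMonomial]
    | succ t ih =>
      rw [rowMonomial_succ, rowMonomial_succ, ih (by omega), rootVec_congr h (by omega)]
  have h2 : ∀ t ≤ n, orderedMonomial r g m t = orderedMonomial r g' m t := by
    intro t ht
    induction t with
    | zero => simp [orderedMonomial]
    | succ t ih => rw [orderedMonomial_succ, orderedMonomial_succ, ih (by omega), h' t t ht le_rfl]
  exact h2 n le_rfl

end RootVectors

/-! ### The height filtration and leading parts of operators -/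

section Height

/-- The height of a basis vector of the Fock space. -/
def height (n : ℕ) (a : ℕ → ℕ → ℤ) : ℤ :=
  -∑ k ∈ Finset.range n, ∑ j ∈ Finset.range n, (j : ℤ) * a k j

theorem height_add (n : ℕ) (a b : ℕ → ℕ → ℤ) : height n (a + b) = height n a + height n b := by
  simp only [height, Pi.add_apply, mul_add, Finset.sum_add_distrib]
  ring

theorem height_single {n k : ℕ} (hk : k < n) (δ : ℕ → ℤ) :
    height n (Pi.single k δ) = -∑ j ∈ Finset.range n, (j : ℤ) * δ j := by
  unfold height
  rw [Finset.sum_eq_single_of_mem k (Finset.mem_range.2 hk)]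
  · simp
  · intro b _ hb
    simp [Pi.single_eq_of_ne hb]

theorem sum_mul_single {n l : ℕ} (hl : l < n) :
    ∑ j ∈ Finset.range n, (j : ℤ) * (Pi.single l 1 : ℕ → ℤ) j = l := by
  rw [Finset.sum_eq_single_of_mem l (Finset.mem_range.2 hl)]
  · simp
  · intro b _ hb
    simp [Pi.single_eq_of_ne hb]

theorem height_single_sub {n k l l' : ℕ} (hk : k < n) (hl : l < n) (hl' : l' < n) :
    height n (Pi.single k (Pi.single l 1 - Pi.single l' 1)) = l' - l := by
  rw [height_single hk]
  simp only [Pi.sub_apply, mul_sub, Finset.sum_sub_distrib, sum_mul_single hl, sum_mul_single hl']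
  ring

/-- The span of the basis vectors of height at most `h`. -/
def filt (n : ℕ) (h : ℤ) : Submodule ℂ Fock := Finsupp.supported ℂ ℂ {a | height n a ≤ h}

theorem filt_mono (n : ℕ) {h h' : ℤ} (hh : h ≤ h') : filt n h ≤ filt n h' :=
  Finsupp.supported_mono fun _ ha => le_trans ha hh

/-- The operators, acting from the right, that raise the height by at most `d`. -/
def degLE (n : ℕ) (d : ℤ) : Submodule ℂ (Module.End ℂ Fock)ᵐᵒᵖ where
  carrier := {T | ∀ h, ∀ y ∈ filt n h, T.unop y ∈ filt n (h + d)}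
  add_mem' hS hT h y hy := add_mem (hS h y hy) (hT h y hy)
  zero_mem' _ _ _ := zero_mem _
  smul_mem' c _ hT h y hy := Submodule.smul_mem _ c (hT h y hy)

theorem mul_mem_degLE {n : ℕ} {d d' e : ℤ} {S T : (Module.End ℂ Fock)ᵐᵒᵖ} (hS : S ∈ degLE n d)
    (hT : T ∈ degLE n d') (he : e = d + d') : S * T ∈ degLE n e := by
  intro h y hy
  subst he
  rw [← add_assoc]
  exact hT _ _ (hS _ _ hy)

theorem one_mem_degLE (n : ℕ) : 1 ∈ degLE n 0 := by
  intro h y hy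
  simpa using hy

theorem rowOp_mem_degLE {n k : ℕ} {d : ℤ} {δ : ℕ → ℤ} (h : height n (Pi.single k δ) ≤ d)
    (w : (ℕ → ℤ) → ℂ) : MulOpposite.op (rowOp k w δ) ∈ degLE n d := by
  intro e y hy
  simp only [MulOpposite.unop_op, rowOp, shiftOp, Finsupp.linearCombination_apply, Finsupp.sum]
  refine Submodule.sum_mem _ fun a ha => Submodule.smul_mem _ _ ?_
  refine Finsupp.single_mem_supported _ _ ?_
  have := (Finsupp.mem_supported _ _).1 hy ha
  simp only [Set.mem_ofPred_eq] at this ⊢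
  rw [height_add]
  omega

theorem mul_sub_mul_eq_mul_sub_add_sub_mul {B : Type*} [Ring B] (a b c d : B) :
    a * c - b * d = a * (c - d) + (a - b) * d := by noncomm_ring

theorem sub_eq_add_neg_one_smul {B : Type*} [Ring B] [Algebra ℂ B] (a b : B) :
    a - b = a + (-1 : ℂ) • b := by rw [neg_one_smul, sub_eq_add_neg]

/-- `T` and `S` raise the height by at most `d`, and agree up to terms of lower height. -/
structure SameLead (n : ℕ) (d : ℤ) (T S : (Module.End ℂ Fock)ᵐᵒᵖ) : Prop where
  left : T ∈ degLE n d
  right : S ∈ degLE n d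
  sub : T - S ∈ degLE n (d - 1)

namespace SameLead

variable {n : ℕ} {d d' e : ℤ} {T S T' S' : (Module.End ℂ Fock)ᵐᵒᵖ}

theorem refl (h : T ∈ degLE n d) : SameLead n d T T :=
  ⟨h, h, by
    have e : T - T = 0 := sub_self T
    rw [e]
    exact zero_mem _⟩

theorem mul (h : SameLead n d T S) (h' : SameLead n d' T' S') (he : e = d + d') :
    SameLead n e (T * T') (S * S') := by
  refine ⟨mul_mem_degLE h.left h'.left he, mul_mem_degLE h.right h'.right he, ?_⟩
  have : T * T' - S * S' = T * (T' - S') + (T - S) * S' :=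
    mul_sub_mul_eq_mul_sub_add_sub_mul T S T' S'
  rw [this]
  exact add_mem (mul_mem_degLE h.left h'.sub (by omega)) (mul_mem_degLE h.sub h'.right (by omega))

theorem add (h : SameLead n d T S) (h' : SameLead n d T' S') :
    SameLead n d (T + T') (S + S') :=
  ⟨add_mem h.left h'.left, add_mem h.right h'.right, by
    have e : T + T' - (S + S') = (T - S) + (T' - S') := add_sub_add_comm T T' S S'
    rw [e]
    exact add_mem h.sub h'.sub⟩

theorem smul (c : ℂ) (h : SameLead n d T S) : SameLead n d (c • T) (c • S) :=
  ⟨Submodule.smul_mem _ _ h.left, Submodule.smul_mem _ _ h.right, by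
    have e : c • T - c • S = c • (T - S) := (smul_sub c T S).symm
    rw [e]
    exact Submodule.smul_mem _ _ h.sub⟩

theorem subtract (h : SameLead n d T S) (h' : SameLead n d T' S') :
    SameLead n d (T - T') (S - S') := by
  have e : ∀ X Y : (Module.End ℂ Fock)ᵐᵒᵖ, X - Y = X + (-1 : ℂ) • Y := fun X Y =>
    sub_eq_add_neg_one_smul X Y
  rw [e, e]
  exact h.add (h'.smul (-1))

theorem pow (h : SameLead n d T S) (m : ℕ) : SameLead n (d * m) (T ^ m) (S ^ m) := by
  induction m with
  | zero => simpa using refl (one_mem_degLE n)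
  | succ m ih =>
    rw [pow_succ, pow_succ]
    exact ih.mul h (by push_cast; ring)

theorem rootVec {r : ℂ} {g g' : ℕ → (Module.End ℂ Fock)ᵐᵒᵖ}
    (h : ∀ i, i + 1 < n → SameLead n 1 (g i) (g' i)) {l d : ℕ} (hl : l + d + 1 < n) :
    SameLead n (d + 1) (QSo.rootVec r g l d) (QSo.rootVec r g' l d) := by
  induction d generalizing l with
  | zero => simpa [QSo.rootVec] using h l hl
  | succ d ih =>
    have h1 := h l (by omega)
    have h2 := ih (l := l + 1) (by omega)
    exact ((h1.mul h2 (by push_cast; ring)).smul r).subtract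
      ((h2.mul h1 (by push_cast; ring)).smul r⁻¹)

theorem rowMonomial {r : ℂ} {g g' : ℕ → (Module.End ℂ Fock)ᵐᵒᵖ}
    (h : ∀ i, i + 1 < n → SameLead n 1 (g i) (g' i)) {k t : ℕ} (hk : k < n) (ht : t ≤ k)
    (m : ℕ → ℕ) :
    SameLead n (∑ l ∈ Finset.range t, ((k : ℤ) - l) * m l)
      (QSo.rowMonomial r g k m t) (QSo.rowMonomial r g' k m t) := by
  induction t with
  | zero => simpa [QSo.rowMonomial] using refl (one_mem_degLE n)
  | succ t ih =>
    rw [rowMonomial_succ, rowMonomial_succ, Finset.sum_range_succ]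
    refine (ih (by omega)).mul ((rootVec h (l := t) (d := k - t - 1) (by omega)).pow (m t)) ?_
    congr 2
    omega

theorem orderedMonomial {r : ℂ} {g g' : ℕ → (Module.End ℂ Fock)ᵐᵒᵖ}
    (h : ∀ i, i + 1 < n → SameLead n 1 (g i) (g' i)) {t : ℕ} (ht : t ≤ n) (m : ℕ → ℕ → ℕ) :
    SameLead n (∑ k ∈ Finset.range t, ∑ l ∈ Finset.range k, ((k : ℤ) - l) * m k l)
      (QSo.orderedMonomial r g m t) (QSo.orderedMonomial r g' m t) := by
  induction t with
  | zero => simpa [QSo.orderedMonomial] using refl (one_mem_degLE n)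
  | succ t ih =>
    rw [orderedMonomial_succ, orderedMonomial_succ, Finset.sum_range_succ]
    exact (ih (by omega)).mul (rowMonomial h ht le_rfl (m t)) rfl

end SameLead

/-- The summand `rowE` lowers the height by one, so in degree one it has the same leading part as
zero. -/
theorem sameLead_actJ_actF (r : ℂ) {n N i : ℕ} (hN : N ≤ n) (hi : i + 1 < n) :
    SameLead n 1 (MulOpposite.op (actJ r N i)) (MulOpposite.op (actF r N i)) := by
  induction N with
  | zero => exact SameLead.refl (zero_mem _)
  | succ N ih =>
    have hl : height n (Pi.single N (lower i)) = 1 := by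
      rw [lower, height_single_sub (by omega) (by omega) (by omega)]
      push_cast
      ring
    have hl' : height n (Pi.single N (-lower i)) = -1 := by
      rw [lower, neg_sub, height_single_sub (by omega) (by omega) (by omega)]
      push_cast
      ring
    have hK : SameLead n 0 (MulOpposite.op (rowK r N i)) (MulOpposite.op (rowK r N i)) :=
      SameLead.refl (rowOp_mem_degLE (by simp [height]) _)
    have hF : SameLead n 1 (MulOpposite.op (rowF r N i)) (MulOpposite.op (rowF r N i)) :=
      SameLead.refl (rowOp_mem_degLE hl.le _)
    have hE : SameLead n 1 (MulOpposite.op (rowE r N i)) 0 :=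
      ⟨rowOp_mem_degLE (by omega) _, zero_mem _, by
        have e : MulOpposite.op (rowE r N i) - 0 = MulOpposite.op (rowE r N i) :=
          sub_zero (MulOpposite.op (rowE r N i))
        rw [e]
        exact rowOp_mem_degLE (by omega) _⟩
    have := ((hK.mul (ih (by omega)) (by ring)).add hF).add hE
    simpa only [actJ, actF, MulOpposite.op_add, MulOpposite.op_mul, add_zero] using this

end Height

/-! ### Leading terms of ordered monomials applied to the vacuum -/

section LeadingTerms

variable {r : ℂ}

/-- The basis vectors whose row `k` is `b`, whose later rows vanish and whose earlier rows are
supported on or to the left of the diagonal. -/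
def stage (k : ℕ) (b : ℕ → ℤ) : Set (ℕ → ℕ → ℤ) :=
  {a | a k = b ∧ (∀ k', k < k' → a k' = 0) ∧ ∀ k' < k, ∀ j, k' < j → a k' j = 0}

theorem eqOn_supported {s : Set (ℕ → ℕ → ℤ)} {S T : Module.End ℂ Fock}
    (h : ∀ a ∈ s, S (Finsupp.single a 1) = T (Finsupp.single a 1)) {y : Fock}
    (hy : y ∈ Finsupp.supported ℂ ℂ s) : S y = T y := by
  rw [Finsupp.supported_eq_span_single] at hy
  refine LinearMap.eqOn_span ?_ hy
  rintro _ ⟨a, ha, rfl⟩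
  exact h a ha

theorem rowF_single_eq_zero {k i : ℕ} {a : ℕ → ℕ → ℤ} (h : a k (i + 1) = 0) (hk : i + 1 ≠ k) :
    rowF r k i (Finsupp.single a 1) = 0 := by
  simp [rowF, rowOp_single, downCoeff, h, hk]

theorem actF_succ_single (N i : ℕ) (a : ℕ → ℕ → ℤ) :
    actF r (N + 1) i (Finsupp.single a 1) =
      (r ^ 2) ^ (a N (i + 1) - a N i) • actF r N i (Finsupp.single a 1) +
        rowF r N i (Finsupp.single a 1) := by
  have : rowK r N i (Finsupp.single a 1) =
      (r ^ 2) ^ (a N (i + 1) - a N i) • Finsupp.single a 1 := by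
    simp [rowK, rowOp_single]
  rw [actF, LinearMap.add_apply, Module.End.mul_apply, this, map_smul]

theorem actF_single_mem_supported {k i N : ℕ} (hN : N ≤ k) {b : ℕ → ℤ} {a : ℕ → ℕ → ℤ}
    (ha : a ∈ stage k b) :
    actF r N i (Finsupp.single a 1) ∈ Finsupp.supported ℂ ℂ (stage k b) := by
  induction N with
  | zero => exact zero_mem _
  | succ N ih =>
    rw [actF_succ_single]
    refine add_mem (Submodule.smul_mem _ _ (ih (by omega))) ?_
    by_cases h : N < i + 1
    · rw [rowF_single_eq_zero (ha.2.2 N hN _ h) h.ne']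
      exact zero_mem _
    · rw [rowF, rowOp_single]
      refine Finsupp.single_mem_supported _ _ ⟨?_, fun k' hk' => ?_, fun k' hk' j hj => ?_⟩
      · simp [Pi.single_eq_of_ne (show k ≠ N by omega), ha.1]
      · simp [Pi.single_eq_of_ne (show k' ≠ N by omega), ha.2.1 k' hk']
      · rw [Pi.add_apply, Pi.add_apply, ha.2.2 k' hk' j hj, zero_add]
        by_cases hkN : k' = N
        · subst hkN
          rw [Pi.single_eq_same, lower_eq_zero (by omega) (by omega)]
        · simp [Pi.single_eq_of_ne hkN]

/-- An empty row $k'>k$ contributes nothing: column $i+1\le k$ is off its diagonal, so there is no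
variable to lower, and its group-like factor is $1$. -/
theorem actF_single_of_rows_eq_zero {k i N : ℕ} (hN : k + 1 ≤ N) (hi : i < k) {a : ℕ → ℕ → ℤ}
    (ha : ∀ k', k < k' → a k' = 0) :
    actF r N i (Finsupp.single a 1) = actF r (k + 1) i (Finsupp.single a 1) := by
  induction N, hN using Nat.le_induction with
  | base => rfl
  | succ N hN ih =>
    have h0 : a N = 0 := ha N (by omega)
    rw [actF_succ_single, ih, rowF_single_eq_zero (by simp [h0]) (by omega)]
    simp [h0]

theorem actF_single_eq_zero {k N : ℕ} (hN : N ≤ k) {i : ℕ} (hi : k = i + 1) {b : ℕ → ℤ}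
    {a : ℕ → ℕ → ℤ} (ha : a ∈ stage k b) : actF r N i (Finsupp.single a 1) = 0 := by
  induction N with
  | zero => rfl
  | succ N ih =>
    rw [actF_succ_single, ih (by omega),
      rowF_single_eq_zero (ha.2.2 N hN _ (by omega)) (by omega)]
    simp

/-- The shift multiplying by `x_{kl}`. -/
def raise (k l : ℕ) : ℕ → ℤ := Pi.single l 1 - Pi.single k 1

theorem raise_mem_stage {k : ℕ} {b : ℕ → ℤ} {a : ℕ → ℕ → ℤ} (ha : a ∈ stage k b)
    (δ : ℕ → ℤ) : a + Pi.single k δ ∈ stage k (b + δ) := by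
  refine ⟨by simp [ha.1], fun k' hk' => ?_, fun k' hk' j hj => ?_⟩
  · simp [Pi.single_eq_of_ne hk'.ne', ha.2.1 k' hk']
  · simp [Pi.single_eq_of_ne hk'.ne, ha.2.2 k' hk' j hj]

/-- Induction on $d$. For $d=0$ only the diagonal column of row $k$ can be lowered. In the inductive
step $I_{k,l+1}$ multiplies by $x_{k,l+1}/x_{kk}$, which changes the group-like factor
$q^{a_{l+1}-a_l}$ of row $k$ by $q=r^2$. Since $r-r^{-1}r^2=0$, the contributions of the earlier
rows cancel in the bracket. What remains is $-r^{-1}$ times the action of $f_l$ on the new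
$x_{k,l+1}$, whose coefficient is $-r$. -/
theorem rootVec_actF (hr : r ≠ 0) {n k l d : ℕ} (hk : k < n) (hl : l + d + 1 = k) {b : ℕ → ℤ}
    (hb : ∀ j, l < j → j ≠ k → b j = 0) {y : Fock}
    (hy : y ∈ Finsupp.supported ℂ ℂ (stage k b)) :
    (rootVec r (fun i => MulOpposite.op (actF r n i)) l d).unop y =
      rowOp k (fun _ => 1) (raise k l) y := by
  have hq : r ^ 2 ≠ 0 := pow_ne_zero 2 hr
  induction d generalizing l b y with
  | zero =>
    simp only [rootVec, MulOpposite.unop_op]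
    refine eqOn_supported (fun a ha => ?_) hy
    rw [actF_single_of_rows_eq_zero (k := k) (by omega) (by omega) ha.2.1, actF_succ_single,
      actF_single_eq_zero le_rfl (by omega) ha, smul_zero, zero_add, rowF, rowOp_single,
      rowOp_single]
    have h1 : l + 1 = k := by omega
    have h2 : l ≠ k := by omega
    simp [downCoeff, upCoeff, h1, h2, lower, raise, hr]
  | succ d ih =>
    have h1 : l + 1 ≠ k := by omega
    have h2 : l ≠ k := by omega
    simp only [rootVec, qBracket, MulOpposite.unop_sub, MulOpposite.unop_smul,
      MulOpposite.unop_mul]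
    refine eqOn_supported (fun a ha => ?_) hy
    have hR : ∀ {b : ℕ → ℤ}, (∀ j, l + 1 < j → j ≠ k → b j = 0) → ∀ {y : Fock},
        y ∈ Finsupp.supported ℂ ℂ (stage k b) →
        (rootVec r (fun i => MulOpposite.op (actF r n i)) (l + 1) d).unop y =
          rowOp k (fun _ => 1) (raise k (l + 1)) y := by
      intro b hb y hy
      exact ih (by omega) hb hy
    have hF : ∀ {b : ℕ → ℤ} {a : ℕ → ℕ → ℤ}, a ∈ stage k b → actF r n l (Finsupp.single a 1) =
        (r ^ 2) ^ (a k (l + 1) - a k l) • actF r k l (Finsupp.single a 1) +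
          rowF r k l (Finsupp.single a 1) := by
      intro b a ha
      rw [actF_single_of_rows_eq_zero (k := k) (by omega) (by omega) ha.2.1, actF_succ_single]
    have hb1 : a k (l + 1) = 0 := by rw [ha.1]; exact hb _ (by omega) h1
    have hb' : ∀ j, l + 1 < j → j ≠ k → b j = 0 := fun j hj => hb j (by omega)
    have ha' := raise_mem_stage ha (raise k (l + 1))
    have hcomm := LinearMap.congr_fun
      (actF_commute_rowOp (r := r) (le_refl k) l (fun _ => 1) (raise k (l + 1))).eq
      (Finsupp.single a 1)
    simp only [Module.End.mul_apply, rowOp_single, mul_one] at hcomm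
    simp only [LinearMap.sub_apply, LinearMap.smul_apply, Module.End.mul_apply,
      MulOpposite.unop_op]
    rw [hF ha, rowF_single_eq_zero hb1 h1, add_zero, map_smul,
      hR hb' (actF_single_mem_supported le_rfl ha),
      hR hb' (Finsupp.single_mem_supported _ _ ha), rowOp_single, mul_one, hF ha', hcomm]
    have e1 : (a + Pi.single k (raise k (l + 1)) : ℕ → ℕ → ℤ) k (l + 1) = 1 := by
      simp [raise, hb1, Pi.single_eq_of_ne h1]
    have e2 : (a + Pi.single k (raise k (l + 1)) : ℕ → ℕ → ℤ) k l = a k l := by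
      simp [raise, Pi.single_eq_of_ne h2]
    have e3 : rowF r k l (Finsupp.single (a + Pi.single k (raise k (l + 1))) 1) =
        -r • Finsupp.single (a + Pi.single k (raise k l)) 1 := by
      have e4 : a + Pi.single k (raise k (l + 1)) + Pi.single k (lower l) =
          a + Pi.single k (raise k l) := by
        rw [add_assoc, ← Pi.single_add, raise, lower, raise]
        congr 2
        abel
      rw [rowF, rowOp_single, e1, e2, e4]
      simp [downCoeff, upCoeff, h1, h2, qInt_one hq]
    rw [e1, e2, e3, rowOp_single, hb1, zpow_sub₀ hq 0, zpow_sub₀ hq 1]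
    have hz : (r ^ 2) ^ a k l ≠ 0 := zpow_ne_zero _ hq
    simp only [zpow_zero, zpow_one, mul_one]
    match_scalars <;> field_simp
    ring

/-- The exponents in row `k` produced by multiplying by `x_{kl} ^ m_l` for `l < t`. -/
def rowShift (k : ℕ) (m : ℕ → ℕ) (t : ℕ) : ℕ → ℤ :=
  ∑ l ∈ Finset.range t, (m l : ℤ) • raise k l

theorem rowShift_succ (k : ℕ) (m : ℕ → ℕ) (t : ℕ) :
    rowShift k m (t + 1) = rowShift k m t + (m t : ℤ) • raise k t := Finset.sum_range_succ ..

theorem rowShift_apply {k t j : ℕ} (hj : j ≠ k) (m : ℕ → ℕ) :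
    rowShift k m t j = if j < t then (m j : ℤ) else 0 := by
  simp [rowShift, raise, Finset.sum_apply, Pi.single_apply, hj]

theorem rowMonomial_actF (hr : r ≠ 0) {n k t : ℕ} (hk : k < n) (ht : t ≤ k) (m : ℕ → ℕ)
    {a : ℕ → ℕ → ℤ} (ha : a ∈ stage k 0) :
    (rowMonomial r (fun i => MulOpposite.op (actF r n i)) k m t).unop (Finsupp.single a 1) =
      Finsupp.single (a + Pi.single k (rowShift k m t)) 1 := by
  induction t with
  | zero => simp [rowMonomial, rowShift]
  | succ t ih =>
    rw [rowMonomial_succ, MulOpposite.unop_mul, Module.End.mul_apply, ih (by omega)]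
    have key : ∀ p : ℕ,
        (rootVec r (fun i => MulOpposite.op (actF r n i)) t (k - t - 1) ^ p).unop
          (Finsupp.single (a + Pi.single k (rowShift k m t)) 1) =
        Finsupp.single (a + Pi.single k (rowShift k m t + (p : ℤ) • raise k t)) (1 : ℂ) := by
      intro p
      induction p with
      | zero => simp
      | succ p ihp =>
        have hmem := raise_mem_stage ha (rowShift k m t + (p : ℤ) • raise k t)
        rw [pow_succ, MulOpposite.unop_mul, Module.End.mul_apply, ihp,
          rootVec_actF hr hk (by omega) (b := 0 + (rowShift k m t + (p : ℤ) • raise k t)) _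
            (Finsupp.single_mem_supported _ _ hmem), rowOp_single, add_assoc, ← Pi.single_add]
        · congr 1
          · push_cast
            rw [add_smul, one_smul, add_assoc]
          · simp
        · intro j hj hjk
          simp [rowShift_apply hjk, raise, hjk, hj.ne', hj.not_gt]
    rw [key, ← rowShift_succ]

/-- The exponents of the leading term of the ordered monomial with exponents `m`. -/
def leadExp (m : ℕ → ℕ → ℕ) (t : ℕ) : ℕ → ℕ → ℤ :=
  fun k => if k < t then rowShift k (m k) k else 0

theorem leadExp_succ (m : ℕ → ℕ → ℕ) (t : ℕ) :
    leadExp m (t + 1) = leadExp m t + Pi.single t (rowShift t (m t) t) := by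
  funext k
  by_cases h : k = t
  · subst h
    simp [leadExp]
  · have : k < t + 1 ↔ k < t := by omega
    simp [leadExp, this, Pi.single_eq_of_ne h]

theorem leadExp_mem_stage (m : ℕ → ℕ → ℕ) (t : ℕ) : leadExp m t ∈ stage t 0 := by
  refine ⟨by simp [leadExp], fun k' hk' => ?_, fun k' hk' j hj => ?_⟩
  · simp [leadExp, hk'.not_gt]
  · simp [leadExp, hk', rowShift_apply hj.ne', hj.not_gt]

theorem orderedMonomial_actF (hr : r ≠ 0) {n t : ℕ} (ht : t ≤ n) (m : ℕ → ℕ → ℕ) :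
    (orderedMonomial r (fun i => MulOpposite.op (actF r n i)) m t).unop (Finsupp.single 0 1) =
      Finsupp.single (leadExp m t) 1 := by
  induction t with
  | zero =>
    have : leadExp m 0 = 0 := by funext k; simp [leadExp]
    simp [orderedMonomial, this]
  | succ t ih =>
    rw [orderedMonomial_succ, MulOpposite.unop_mul, Module.End.mul_apply, ih (by omega),
      rowMonomial_actF hr ht le_rfl _ (leadExp_mem_stage m t), leadExp_succ]

theorem height_leadExp {n t : ℕ} (ht : t ≤ n) (m : ℕ → ℕ → ℕ) :
    height n (leadExp m t) =
      ∑ k ∈ Finset.range t, ∑ l ∈ Finset.range k, ((k : ℤ) - l) * m k l := by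
  have hrow : ∀ k < n, ∀ s ≤ k, height n (Pi.single k (rowShift k (m k) s)) =
      ∑ l ∈ Finset.range s, ((k : ℤ) - l) * m k l := by
    intro k hk s hs
    induction s with
    | zero => simp [rowShift, height]
    | succ s ih =>
      rw [rowShift_succ, Pi.single_add, height_add, ih (by omega), Finset.sum_range_succ,
        ← height_single_sub hk (show s < n by omega) hk, height_single hk, height_single hk]
      have e : ∀ x : ℕ, (x : ℤ) * ((m k s : ℤ) • raise k s) x = m k s * (x * raise k s x) := by
        intro x
        simp only [Pi.smul_apply, smul_eq_mul]
        ring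
      simp only [e, ← Finset.mul_sum]
      simp only [raise]
      ring
  induction t with
  | zero =>
    have : leadExp m 0 = 0 := by funext k; simp [leadExp]
    simp [this, height]
  | succ t ih =>
    rw [leadExp_succ, height_add, ih (by omega), hrow t ht t le_rfl, Finset.sum_range_succ]

/-- In a nontrivial relation choose $i$ of maximal height and read off the coordinate at $\mu_i$: by
maximality no other vector of the relation has a component there. -/
theorem linearIndependent_of_leading {ι : Type*} {n : ℕ} {v : ι → Fock} {μ : ι → ℕ → ℕ → ℤ}
    (hμ : Function.Injective μ)
    (h : ∀ i, v i - Finsupp.single (μ i) 1 ∈ filt n (height n (μ i) - 1)) :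
    LinearIndependent ℂ v := by
  classical
  rw [linearIndependent_iff]
  intro c hc
  by_contra hne
  obtain ⟨i, hi, hmax⟩ := Finset.exists_max_image c.support (fun i => height n (μ i))
    (Finsupp.support_nonempty_iff.2 hne)
  refine Finsupp.mem_support_iff.1 hi ?_
  have hval : ∀ j ∈ c.support, v j (μ i) = if j = i then 1 else 0 := by
    intro j hj
    have h0 : (v j - Finsupp.single (μ j) 1 : Fock) (μ i) = 0 := by
      by_contra hn
      have := (Finsupp.mem_supported _ _).1 (h j) (Finsupp.mem_support_iff.2 hn)
      have h' := hmax j hj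
      simp only [Set.mem_ofPred_eq] at this
      omega
    rw [Finsupp.sub_apply, sub_eq_zero] at h0
    rw [h0, Finsupp.single_apply]
    simp [hμ.eq_iff]
  have := DFunLike.congr_fun hc (μ i)
  rw [Finsupp.linearCombination_apply, Finsupp.sum, Finsupp.finsetSum_apply,
    Finset.sum_congr rfl (fun j hj => by rw [Finsupp.smul_apply, hval j hj])] at this
  simpa [Finset.sum_ite_eq', hi] using this

end LeadingTerms

/-! ### Transfer to the presented algebra; linear independence -/

section Presentation

variable {n : ℕ} {q r : ℂ}

/-- The generator `I_{i+1,i}`, extended by zero to all `i`. -/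
def genNat (n : ℕ) (q : ℂ) (i : ℕ) : U n q := if h : i + 1 < n then gen n q ⟨i, h⟩ else 0

/-- Exponents extended by zero to all pairs of indices. -/
def extendExp (m : Exponents n) (k l : ℕ) : ℕ :=
  if h : k < n then if h' : l < k then m ⟨k, h⟩ ⟨l, h'⟩ else 0 else 0

theorem I_eq_rootVec (k l : ℕ) (hlk : l < k) (hk : k < n) :
    I n q r k l hlk hk = rootVec r (genNat n q) l (k - l - 1) := by
  obtain ⟨d, rfl⟩ : ∃ d, k = l + d + 1 := ⟨k - l - 1, by omega⟩
  rw [show l + d + 1 - l - 1 = d by omega]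
  induction d generalizing l with
  | zero =>
    rw [I, dif_pos rfl, rootVec, genNat, dif_pos (by omega)]
  | succ d ih =>
    have h := ih (l + 1)
    simp only [show l + 1 + d + 1 = l + (d + 1) + 1 by omega] at h
    rw [I, dif_neg (by omega), rootVec, h (by omega) hk, genNat, dif_pos (by omega)]

theorem prod_ofFn_eq {M : Type*} [Monoid M] (n : ℕ) (f : Fin n → M) (g : ℕ → M)
    (h : ∀ i : Fin n, f i = g i) : (List.ofFn f).prod = ((List.range n).map g).prod := by
  congr 1
  refine List.ext_getElem (by simp) fun i h1 h2 => ?_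
  simp [h]

theorem monomial_eq_orderedMonomial (m : Exponents n) :
    monomial n q r m = orderedMonomial r (genNat n q) (extendExp m) n := by
  refine prod_ofFn_eq _ _ _ fun k => ?_
  refine prod_ofFn_eq _ _ _ fun l => ?_
  rw [I_eq_rootVec]
  simp [extendExp]

/-- Reversing words exchanges the two outer terms and fixes the middle one, so the action from the
right also satisfies the relations. -/
theorem serre_op {B : Type*} [Ring B] [Algebra ℂ B] (c : ℂ) (x y : B) :
    serre c (MulOpposite.op x) (MulOpposite.op y) = MulOpposite.op (serre c x y) := by
  apply MulOpposite.unop_injective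
  simp only [serre, MulOpposite.unop_add, MulOpposite.unop_sub, MulOpposite.unop_mul,
    MulOpposite.unop_smul, MulOpposite.unop_pow, MulOpposite.unop_op, mul_assoc]
  abel

/-- The algebra homomorphism from `U'_q(so_n)` determined by elements satisfying the defining
relations. -/
def liftU {B : Type*} [Ring B] [Algebra ℂ B] (g : ℕ → B)
    (h1 : ∀ i, serre (q + q⁻¹) (g i) (g (i + 1)) = -g (i + 1))
    (h2 : ∀ i, serre (q + q⁻¹) (g (i + 1)) (g i) = -g i)
    (h3 : ∀ i j, i + 1 < j → Commute (g i) (g j)) : U n q →ₐ[ℂ] B :=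
  RingQuot.liftAlgHom ℂ ⟨FreeAlgebra.lift ℂ fun i : GenIdx n => g i.1, by
    intro x y hxy
    induction hxy with
    | serre_left i j hij =>
      have := h1 i.1
      rw [← hij] at this
      simpa [serre] using this
    | serre_right i j hij =>
      have := h2 i.1
      rw [← hij] at this
      simp only [serre] at this
      simp only [map_add, map_sub, map_mul, map_pow, map_smul, map_neg, FreeAlgebra.lift_ι_apply]
      rw [← this]
      abel
    | comm i j hij =>
      simp only [map_sub, map_mul, map_zero, FreeAlgebra.lift_ι_apply]
      rcases hij with hij | hij
      · exact sub_eq_zero.2 (h3 _ _ hij).eq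
      · exact sub_eq_zero.2 (h3 _ _ hij).symm.eq⟩

theorem liftU_gen {B : Type*} [Ring B] [Algebra ℂ B] (g : ℕ → B)
    (h1 : ∀ i, serre (q + q⁻¹) (g i) (g (i + 1)) = -g (i + 1))
    (h2 : ∀ i, serre (q + q⁻¹) (g (i + 1)) (g i) = -g i)
    (h3 : ∀ i j, i + 1 < j → Commute (g i) (g j)) {i : ℕ} (hi : i + 1 < n) :
    liftU g h1 h2 h3 (genNat n q i) = g i := by
  rw [genNat, dif_pos hi, gen, liftU, RingQuot.liftAlgHom_mkAlgHom_apply,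
    FreeAlgebra.lift_ι_apply]

theorem liftU_monomial {B : Type*} [Ring B] [Algebra ℂ B] (g : ℕ → B)
    (h1 : ∀ i, serre (q + q⁻¹) (g i) (g (i + 1)) = -g (i + 1))
    (h2 : ∀ i, serre (q + q⁻¹) (g (i + 1)) (g i) = -g i)
    (h3 : ∀ i j, i + 1 < j → Commute (g i) (g j)) (m : Exponents n) :
    liftU g h1 h2 h3 (monomial n q r m) = orderedMonomial r g (extendExp m) n := by
  rw [monomial_eq_orderedMonomial, map_orderedMonomial]
  exact orderedMonomial_congr (fun i hi => liftU_gen _ h1 h2 h3 hi) _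

/-- The entry of row $k$ in a column $l<k$ is $m_{kl}$ itself; only the diagonal entry mixes
exponents. -/
theorem leadExp_extendExp_injective :
    Function.Injective fun m : Exponents n => leadExp (extendExp m) n := by
  intro m m' h
  funext k l
  have := congrFun (congrFun h k) l
  simpa [leadExp, extendExp, rowShift_apply l.2.ne] using this

theorem linearIndependent_monomial (hr : r ≠ 0) (hqr : q + q⁻¹ = r ^ 2 + (r ^ 2)⁻¹) :
    LinearIndependent ℂ (monomial n q r) := by
  have h1 : ∀ i, serre (q + q⁻¹) (MulOpposite.op (actJ r n i)) (MulOpposite.op (actJ r n (i + 1)))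
      = -MulOpposite.op (actJ r n (i + 1)) := fun i => by
    rw [hqr, serre_op, serre_actJ_succ hr, MulOpposite.op_neg]
  have h2 : ∀ i, serre (q + q⁻¹) (MulOpposite.op (actJ r n (i + 1))) (MulOpposite.op (actJ r n i))
      = -MulOpposite.op (actJ r n i) := fun i => by
    rw [hqr, serre_op, serre_actJ_pred hr, MulOpposite.op_neg]
  have h3 : ∀ i j, i + 1 < j →
      Commute (MulOpposite.op (actJ r n i)) (MulOpposite.op (actJ r n j)) :=
    fun i j hij => (actJ_commute hij n).op
  let φ := liftU (n := n) (fun i => MulOpposite.op (actJ r n i)) h1 h2 h3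
  -- Evaluation at the vacuum; independence of the images is enough.
  let L : U n q →ₗ[ℂ] Fock :=
    { toFun := fun x => (φ x).unop (Finsupp.single 0 1)
      map_add' := fun x y => by
        rw [map_add]
        rfl
      map_smul' := fun c x => by
        rw [map_smul]
        rfl }
  refine LinearIndependent.of_comp L ?_
  refine linearIndependent_of_leading (n := n) leadExp_extendExp_injective fun m => ?_
  have hφ : φ (monomial n q r m) =
      orderedMonomial r (fun i => MulOpposite.op (actJ r n i)) (extendExp m) n :=
    liftU_monomial _ h1 h2 h3 m
  have hlead := (SameLead.orderedMonomial (r := r) (t := n) (fun i hi =>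
    sameLead_actJ_actF r (le_refl n) hi) le_rfl (extendExp m)).sub 0 (Finsupp.single 0 1)
    (Finsupp.single_mem_supported _ _ (by simp [height]))
  rw [← height_leadExp le_rfl, zero_add, MulOpposite.unop_sub, LinearMap.sub_apply,
    orderedMonomial_actF hr le_rfl, ← hφ] at hlead
  exact hlead

end Presentation

/-! ### Identities for the q-bracket -/

section Brackets

variable {B : Type*} [Ring B] [Algebra ℂ B] {r : ℂ}

theorem commute_qBracket {x a b : B} (ha : Commute x a) (hb : Commute x b) :
    Commute x (qBracket r a b) :=
  ((ha.mul_right hb).smul_right r).sub_right ((hb.mul_right ha).smul_right r⁻¹)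

/-- As `z` commutes with `a`, bracketing with `z` can be pulled out of the cubic expression. -/
theorem serre_qBracket {c : ℂ} {a b z : B} (h : serre c a b = -b) (hz : Commute a z) :
    serre c a (qBracket r b z) = -qBracket r b z := by
  have e : serre c a (qBracket r b z) = qBracket r (serre c a b) z := by
    have h1 : z * a = a * z := hz.eq.symm
    have h2 : ∀ w, z * (a * w) = a * (z * w) := fun w => by rw [← mul_assoc, h1, mul_assoc]
    simp only [serre, qBracket, pow_two, mul_sub, sub_mul, mul_add, add_mul, mul_smul_comm,
      smul_mul_assoc, mul_assoc, h1, h2]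
    module
  rw [e, h, qBracket, qBracket]
  simp only [neg_mul, mul_neg, smul_neg]
  abel

theorem serre_qBracket_left {c : ℂ} {a b z : B} (h : serre c z b = -b) (hz : Commute a z) :
    serre c z (qBracket r a b) = -qBracket r a b := by
  have e : serre c z (qBracket r a b) = qBracket r a (serre c z b) := by
    have h1 : z * a = a * z := hz.eq.symm
    have h2 : ∀ w, z * (a * w) = a * (z * w) := fun w => by rw [← mul_assoc, h1, mul_assoc]
    simp only [serre, qBracket, pow_two, mul_sub, sub_mul, mul_add, add_mul, mul_smul_comm,
      smul_mul_assoc, mul_assoc, h1, h2]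
    module
  rw [e, h, qBracket, qBracket]
  simp only [neg_mul, mul_neg, smul_neg]
  abel

theorem qBracket_qBracket_left (hr : r ≠ 0) (a b : B) :
    qBracket r (qBracket r a b) a = -serre (r ^ 2 + (r ^ 2)⁻¹) a b := by
  simp only [serre, qBracket, pow_two, mul_sub, sub_mul, mul_smul_comm, smul_mul_assoc, mul_assoc]
  match_scalars <;> field_simp
  ring

theorem qBracket_qBracket_right (hr : r ≠ 0) (a b : B) :
    qBracket r b (qBracket r a b) = -serre (r ^ 2 + (r ^ 2)⁻¹) b a := by
  simp only [serre, qBracket, pow_two, mul_sub, sub_mul, mul_smul_comm, smul_mul_assoc, mul_assoc]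
  match_scalars <;> field_simp
  ring

/-- This lemma and the next two replace the Jacobi identity: brackets may be regrouped when the
appropriate two entries commute. -/
theorem qBracket_assoc {a b z : B} (h : Commute a z) :
    qBracket r a (qBracket r b z) = qBracket r (qBracket r a b) z := by
  have h1 : z * a = a * z := h.eq.symm
  have h2 : ∀ w, z * (a * w) = a * (z * w) := fun w => by rw [← mul_assoc, h1, mul_assoc]
  simp only [qBracket, mul_sub, sub_mul, mul_smul_comm, smul_mul_assoc, mul_assoc, h1, h2]
  module

theorem qBracket_assoc' {b x z : B} (h : Commute b x) :
    qBracket r (qBracket r b z) x = qBracket r b (qBracket r z x) := by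
  have h1 : x * b = b * x := h.eq.symm
  have h2 : ∀ w, x * (b * w) = b * (x * w) := fun w => by rw [← mul_assoc, h1, mul_assoc]
  simp only [qBracket, mul_sub, sub_mul, mul_smul_comm, smul_mul_assoc, mul_assoc, h1, h2]
  module

theorem qBracket_left_comm {g v x : B} (h : Commute g v) :
    qBracket r v (qBracket r g x) = qBracket r g (qBracket r v x) := by
  have h1 : v * g = g * v := h.eq.symm
  have h2 : ∀ w, v * (g * w) = g * (v * w) := fun w => by rw [← mul_assoc, h1, mul_assoc]
  simp only [qBracket, mul_sub, sub_mul, mul_smul_comm, smul_mul_assoc, mul_assoc, h1, h2]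
  module

/-- The commutator times $[2]$ is a combination of the two cubic relations multiplied by `a` and
`z`, so it vanishes, and $[2]$ can be cancelled. -/
theorem commute_qBracket_qBracket (hr : r ≠ 0) (hc : r ^ 2 + (r ^ 2)⁻¹ ≠ 0) {a b z : B}
    (ha : serre (r ^ 2 + (r ^ 2)⁻¹) b a = -a) (hz : serre (r ^ 2 + (r ^ 2)⁻¹) b z = -z)
    (haz : Commute a z) : Commute b (qBracket r a (qBracket r b z)) := by
  set c := r ^ 2 + (r ^ 2)⁻¹ with hcdef
  have h1 : z * a = a * z := haz.eq.symm
  have h2 : ∀ w, z * (a * w) = a * (z * w) := fun w => by rw [← mul_assoc, h1, mul_assoc]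
  have key : c • (b * qBracket r a (qBracket r b z) - qBracket r a (qBracket r b z) * b) =
      -(r ^ 2) • ((serre c b a + a) * z) - (r ^ 2)⁻¹ • ((serre c b z + z) * a) +
        r ^ 2 • (a * (serre c b z + z)) + (r ^ 2)⁻¹ • (z * (serre c b a + a)) := by
    simp only [serre, qBracket, mul_sub, sub_mul, mul_add, add_mul, mul_smul_comm, pow_two,
      smul_mul_assoc, mul_assoc, h1, h2, hcdef]
    match_scalars <;> field_simp <;> ring
  rw [ha, hz] at key
  simp only [neg_add_cancel, zero_mul, mul_zero, smul_zero, sub_zero, add_zero] at key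
  exact sub_eq_zero.1 ((smul_eq_zero_iff_right hc).1 key)

end Brackets

/-! ### Commutation relations between root vectors -/

/-- The defining relations of `U'_q(so_n)` for a sequence `g` of elements of an algebra. -/
structure SoRelations {B : Type*} [Ring B] [Algebra ℂ B] (n : ℕ) (c : ℂ) (g : ℕ → B) : Prop where
  succ : ∀ i, i + 2 < n → serre c (g i) (g (i + 1)) = -g (i + 1)
  pred : ∀ i, i + 2 < n → serre c (g (i + 1)) (g i) = -g i
  comm : ∀ i j, i + 1 < j → j + 1 < n → Commute (g i) (g j)

section RootVectorRelations

variable {B : Type*} [Ring B] [Algebra ℂ B] {r : ℂ} {n : ℕ} {g : ℕ → B}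

theorem commute_rootVec {x : B} {l d : ℕ} (h : ∀ i, l ≤ i → i ≤ l + d → Commute x (g i)) :
    Commute x (rootVec r g l d) := by
  induction d generalizing l with
  | zero => exact h l le_rfl le_rfl
  | succ d ih =>
    exact commute_qBracket (h l le_rfl (by omega)) (ih fun i hi hi' => h i (by omega) (by omega))

namespace SoRelations

theorem commute_rootVec_of_lt {c : ℂ} (H : SoRelations n c g) {i l d : ℕ} (hi : i + 1 < l)
    (hn : l + d + 1 < n) : Commute (g i) (rootVec r g l d) :=
  commute_rootVec fun j hj hj' => H.comm i j (by omega) (by omega)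

theorem serre_gen_rootVec {c : ℂ} (H : SoRelations n c g) {l d : ℕ} (hn : l + 1 + d + 1 < n) :
    serre c (g l) (rootVec r g (l + 1) d) = -rootVec r g (l + 1) d := by
  cases d with
  | zero => exact H.succ l (by omega)
  | succ d =>
    exact serre_qBracket (H.succ l (by omega)) (H.commute_rootVec_of_lt (by omega) (by omega))

variable (H : SoRelations n (r ^ 2 + (r ^ 2)⁻¹) g)
include H

theorem qBracket_rootVec_gen (hr : r ≠ 0) {l d : ℕ} (hn : l + 1 + d + 1 < n) :
    qBracket r (rootVec r g l (d + 1)) (g l) = rootVec r g (l + 1) d := by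
  rw [rootVec, qBracket_qBracket_left hr, H.serre_gen_rootVec hn, neg_neg]

/-- Outer generators far from $i$ are stripped off until $i=l+1$; that case is
`commute_qBracket_qBracket` with $a=g_l$, $b=g_{l+1}$ and $z$ the remaining root vector. It takes at
least four indices, hence the form of `hc`. -/
theorem commute_rootVec_of_mem (hr : r ≠ 0) (hc : 4 ≤ n → r ^ 2 + (r ^ 2)⁻¹ ≠ 0) {i l d : ℕ}
    (hi : l < i) (hi' : i < l + d) (hn : l + d + 1 < n) :
    Commute (g i) (rootVec r g l d) := by
  obtain ⟨t, rfl⟩ : ∃ t, i = l + 1 + t := ⟨i - l - 1, by omega⟩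
  induction t generalizing l d with
  | zero =>
    obtain ⟨d, rfl⟩ : ∃ e, d = e + 1 + 1 := ⟨d - 2, by omega⟩
    exact commute_qBracket_qBracket hr (hc (by omega)) (H.pred l (by omega))
      (H.serre_gen_rootVec (by omega)) (H.commute_rootVec_of_lt (by omega) (by omega))
  | succ t ih =>
    obtain ⟨d, rfl⟩ : ∃ e, d = e + 1 := ⟨d - 1, by omega⟩
    refine commute_qBracket (H.comm l _ (by omega) (by omega)).symm ?_
    have := ih (l := l + 1) (d := d) (by omega) (by omega) (by omega)
    rwa [show l + 1 + (t + 1) = l + 1 + 1 + t by omega]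

/-- Let $a=g_l$, $b=g_{l+1}$, $z$ the root vector starting at $l+2$, and $X=[a,[b,z]]=[[a,b],z]$. By
induction $[z,X]=[a,b]$. Since $b$ commutes with $X$, it follows that
$[[b,z],X]=[b,[z,X]]=[b,[a,b]]=a$. The left side is also minus the cubic expression in $[b,z]$ and
$a$. -/
theorem serre_rootVec_gen (hr : r ≠ 0) (hc : 4 ≤ n → r ^ 2 + (r ^ 2)⁻¹ ≠ 0) {l d : ℕ}
    (hn : l + 1 + d + 1 < n) :
    serre (r ^ 2 + (r ^ 2)⁻¹) (rootVec r g (l + 1) d) (g l) = -g l := by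
  induction d generalizing l with
  | zero => exact H.pred l (by omega)
  | succ d ih =>
    have haz : Commute (g l) (rootVec r g (l + 1 + 1) d) :=
      H.commute_rootVec_of_lt (by omega) (by omega)
    have hbx : Commute (g (l + 1)) (rootVec r g l (d + 1 + 1)) :=
      H.commute_rootVec_of_mem hr hc (by omega) (by omega) (by omega)
    have hzb := serre_qBracket_left (r := r) (ih (l := l + 1) (by omega)) haz
    have h1 : qBracket r (rootVec r g (l + 1 + 1) d) (rootVec r g l (d + 1 + 1)) =
        qBracket r (g l) (g (l + 1)) := by
      rw [rootVec, rootVec, qBracket_assoc haz, qBracket_qBracket_right hr, hzb, neg_neg]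
    have h2 : qBracket r (rootVec r g (l + 1) (d + 1)) (rootVec r g l (d + 1 + 1)) = g l := by
      rw [rootVec.eq_2 r g (l + 1) d, qBracket_assoc' hbx, h1, qBracket_qBracket_right hr,
        H.pred l (by omega), neg_neg]
    rw [rootVec.eq_2 r g l, qBracket_qBracket_right hr] at h2
    rw [← h2, neg_neg]
    exact congrArg _ h2

/-- In the notation of $I_{kl}$ this is $[I_{ky},I_{kx}]=I_{yx}$ for $x<y<k$, with $x=m$, $y=m+e+1$
and $k=y+d+1$. -/
theorem qBracket_rootVec_rootVec (hr : r ≠ 0) (hc : 4 ≤ n → r ^ 2 + (r ^ 2)⁻¹ ≠ 0) {m e d : ℕ}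
    (hn : m + e + 1 + d + 1 < n) :
    qBracket r (rootVec r g (m + e + 1) d) (rootVec r g m (e + d + 1)) = rootVec r g m e := by
  induction e generalizing m with
  | zero =>
    rw [zero_add, rootVec.eq_2, add_zero, qBracket_qBracket_right hr,
      H.serre_rootVec_gen hr hc (by omega), neg_neg, rootVec]
  | succ e ih =>
    have h := ih (m := m + 1) (by omega)
    rw [show m + 1 + e + 1 = m + (e + 1) + 1 by omega] at h
    rw [rootVec.eq_2 r g m, show e + 1 + d = e + d + 1 by omega,
      qBracket_left_comm (H.commute_rootVec_of_lt (by omega) (by omega)), h, rootVec]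

end SoRelations

end RootVectorRelations

/-! ### Sorting words over a subalgebra -/

section Reordering

variable {B : Type*} [Ring B] [Algebra ℂ B]

/-- The product of the elements `v l` along a word. -/
def wordProd {M : Type*} [Monoid M] (v : ℕ → M) (w : List ℕ) : M := (w.map v).prod

/-- The span of the words of length less than `d` in the letters `v l` with `l < k`. -/
def wordSpan (v : ℕ → B) (k d : ℕ) : Submodule ℂ B :=
  Submodule.span ℂ (wordProd v '' {w | w.length < d ∧ ∀ x ∈ w, x < k})

/-- The span of the letters `v l` with `l < k`. -/
def letterSpan (v : ℕ → B) (k : ℕ) : Submodule ℂ B := Submodule.span ℂ (v '' {l | l < k})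

/-- The word with `m l` letters `l`, in increasing order, for `l < t`. -/
def sortedWord (m : ℕ → ℕ) (t : ℕ) : List ℕ :=
  (List.range t).flatMap fun l => List.replicate (m l) l

theorem sortedWord_succ (m : ℕ → ℕ) (t : ℕ) :
    sortedWord m (t + 1) = sortedWord m t ++ List.replicate (m t) t := by
  simp [sortedWord, List.range_succ]

theorem count_sortedWord (m : ℕ → ℕ) (t x : ℕ) :
    (sortedWord m t).count x = if x < t then m x else 0 := by
  induction t with
  | zero => simp [sortedWord]
  | succ t ih =>
    rw [sortedWord_succ, List.count_append, ih, List.count_replicate]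
    rcases lt_trichotomy x t with h | rfl | h
    · simp [h, h.ne', Nat.lt_succ_of_lt h]
    · simp
    · have h1 : ¬ x < t + 1 := by omega
      simp [h.not_gt, h.ne, h1]

theorem perm_sortedWord {w : List ℕ} {k : ℕ} (hw : ∀ x ∈ w, x < k) :
    w.Perm (sortedWord (fun l => w.count l) k) := by
  rw [List.perm_iff_count]
  intro x
  rw [count_sortedWord]
  split_ifs with h
  · rfl
  · exact List.count_eq_zero_of_not_mem fun hx => h (hw x hx)

theorem wordProd_cons {M : Type*} [Monoid M] (v : ℕ → M) (x : ℕ) (w : List ℕ) :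
    wordProd v (x :: w) = v x * wordProd v w := by simp [wordProd]

theorem wordProd_append {M : Type*} [Monoid M] (v : ℕ → M) (w w' : List ℕ) :
    wordProd v (w ++ w') = wordProd v w * wordProd v w' := by simp [wordProd]

theorem wordProd_sortedWord {M : Type*} [Monoid M] (v : ℕ → M) (m : ℕ → ℕ) (t : ℕ) :
    wordProd v (sortedWord m t) = ((List.range t).map fun l => v l ^ m l).prod := by
  induction t with
  | zero => simp [sortedWord, wordProd]
  | succ t ih =>
    rw [sortedWord_succ, wordProd_append, ih, List.range_succ]
    simp [wordProd]

theorem wordSpan_mono (v : ℕ → B) (k : ℕ) {d d' : ℕ} (h : d ≤ d') :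
    wordSpan v k d ≤ wordSpan v k d' :=
  Submodule.span_mono (Set.image_mono fun _ hw => ⟨hw.1.trans_le h, hw.2⟩)

theorem wordProd_mem_wordSpan (v : ℕ → B) {k d : ℕ} {w : List ℕ} (hd : w.length < d)
    (hw : ∀ x ∈ w, x < k) : wordProd v w ∈ wordSpan v k d :=
  Submodule.subset_span ⟨w, ⟨hd, hw⟩, rfl⟩

theorem letterSpan_mul_wordSpan_le (v : ℕ → B) (k d : ℕ) :
    letterSpan v k * wordSpan v k d ≤ wordSpan v k (d + 1) := by
  rw [letterSpan, wordSpan, Submodule.span_mul_span, Submodule.span_le]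
  rintro _ ⟨_, ⟨l, hl, rfl⟩, _, ⟨w, hw, rfl⟩, rfl⟩
  refine Submodule.subset_span ⟨l :: w, ⟨by simpa using hw.1, ?_⟩, wordProd_cons ..⟩
  intro x hx
  rcases List.mem_cons.1 hx with rfl | hx
  · exact hl
  · exact hw.2 x hx

variable {A : Subalgebra ℂ B} {v : ℕ → B} {k : ℕ}

theorem toSubmodule_mul_mul (A : Subalgebra ℂ B) (M : Submodule ℂ B) :
    Subalgebra.toSubmodule A * (Subalgebra.toSubmodule A * M) = Subalgebra.toSubmodule A * M := by
  rw [← mul_assoc, Subalgebra.isIdempotentElem_toSubmodule A]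

theorem le_toSubmodule_mul (A : Subalgebra ℂ B) (M : Submodule ℂ B) :
    M ≤ Subalgebra.toSubmodule A * M := fun x hx => by
  simpa using Submodule.mul_mem_mul (show 1 ∈ Subalgebra.toSubmodule A from A.one_mem) hx

/-- Induction on the permutation: a swap costs an element of `A` in place of two letters, and a
letter in front of a coefficient from `A` is moved past it by `hA`, leaving some letter behind. -/
theorem exists_wordProd_sub_mem
    (hA : letterSpan v k * Subalgebra.toSubmodule A ≤ Subalgebra.toSubmodule A * letterSpan v k)
    (hv : ∀ x < k, ∀ y < k, ∃ c : ℂ, v y * v x - c • (v x * v y) ∈ A) {w w' : List ℕ}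
    (h : w.Perm w') (hw : ∀ x ∈ w, x < k) :
    ∃ c : ℂ, wordProd v w - c • wordProd v w' ∈
      Subalgebra.toSubmodule A * wordSpan v k w.length := by
  induction h with
  | nil => exact ⟨1, by simp⟩
  | @cons x w w' h ih =>
    obtain ⟨c, hc⟩ := ih fun y hy => hw y (List.mem_cons_of_mem _ hy)
    refine ⟨c, ?_⟩
    have hx : v x ∈ letterSpan v k :=
      Submodule.subset_span ⟨x, hw x List.mem_cons_self, rfl⟩
    have := Submodule.mul_mem_mul hx hc
    rw [wordProd_cons, wordProd_cons, ← mul_smul_comm, ← mul_sub]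
    rw [← mul_assoc] at this
    have h2 := mul_le_mul' hA le_rfl this
    rw [mul_assoc] at h2
    exact mul_le_mul' le_rfl (letterSpan_mul_wordSpan_le v k _) h2
  | swap x y w =>
    obtain ⟨c, hc⟩ := hv x (hw x (by simp)) y (hw y (by simp))
    refine ⟨c, ?_⟩
    have := Submodule.mul_mem_mul (M := Subalgebra.toSubmodule A) hc
      (wordProd_mem_wordSpan v (show w.length < (y :: x :: w).length by simp)
        fun z hz => hw z (by simp [hz]))
    convert this using 1
    simp only [wordProd_cons, sub_mul, smul_mul_assoc, mul_assoc]
  | @trans w₁ w₂ w₃ h h' ih ih' =>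
    obtain ⟨c, hc⟩ := ih hw
    obtain ⟨c', hc'⟩ := ih' fun x hx => hw x (h.mem_iff.2 hx)
    refine ⟨c * c', ?_⟩
    rw [← h.length_eq] at hc'
    have := add_mem hc (Submodule.smul_mem _ c hc')
    convert this using 1
    rw [smul_sub, smul_smul]
    abel

/-- Words can be reordered, modulo shorter words, at the cost of coefficients in `A`. -/
theorem wordSpan_le_mul_span_sorted
    (hA : letterSpan v k * Subalgebra.toSubmodule A ≤ Subalgebra.toSubmodule A * letterSpan v k)
    (hv : ∀ x < k, ∀ y < k, ∃ c : ℂ, v y * v x - c • (v x * v y) ∈ A) (d : ℕ) :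
    wordSpan v k d ≤ Subalgebra.toSubmodule A * Submodule.span ℂ
      (Set.range fun m : ℕ → ℕ => ((List.range k).map fun l => v l ^ m l).prod) := by
  induction d with
  | zero =>
    rw [wordSpan, Submodule.span_le]
    rintro _ ⟨w, ⟨hw, -⟩, rfl⟩
    exact absurd hw (Nat.not_lt_zero _)
  | succ d ih =>
    rw [wordSpan, Submodule.span_le]
    rintro _ ⟨w, ⟨hw, hwk⟩, rfl⟩
    obtain ⟨c, hc⟩ := exists_wordProd_sub_mem hA hv (perm_sortedWord hwk) hwk
    have h1 := mul_le_mul' le_rfl ((wordSpan_mono v k (Nat.le_of_lt_succ hw)).trans ih) hc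
    rw [toSubmodule_mul_mul] at h1
    rw [SetLike.mem_coe, ← sub_add_cancel (wordProd v w)]
    refine add_mem h1 (Submodule.smul_mem _ _ ?_)
    rw [wordProd_sortedWord]
    exact le_toSubmodule_mul _ _ (Submodule.subset_span ⟨_, rfl⟩)

theorem wordSpan_mul_le
    (hA : letterSpan v k * Subalgebra.toSubmodule A ≤ Subalgebra.toSubmodule A * letterSpan v k)
    (d : ℕ) : wordSpan v k d * Subalgebra.toSubmodule A ≤
      Subalgebra.toSubmodule A * wordSpan v k d := by
  have h : ∀ w : List ℕ, (∀ x ∈ w, x < k) → ∀ a ∈ A, wordProd v w * a ∈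
      Subalgebra.toSubmodule A * wordSpan v k (w.length + 1) := by
    intro w hw a ha
    induction w with
    | nil =>
      have := Submodule.mul_mem_mul (M := Subalgebra.toSubmodule A) ha
        (wordProd_mem_wordSpan v (k := k) (d := 1) (w := []) (by simp) (by simp))
      simpa [wordProd] using this
    | cons x w ih =>
      have hx : v x ∈ letterSpan v k :=
        Submodule.subset_span ⟨x, hw x List.mem_cons_self, rfl⟩
      have := Submodule.mul_mem_mul hx (ih fun y hy => hw y (List.mem_cons_of_mem _ hy))
      rw [← mul_assoc] at this
      have h2 := mul_le_mul' hA le_rfl this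
      rw [mul_assoc] at h2
      rw [wordProd_cons, mul_assoc]
      exact mul_le_mul' le_rfl (letterSpan_mul_wordSpan_le v k _) h2
  rw [Submodule.mul_le]
  intro x hx a ha
  induction hx using Submodule.span_induction with
  | mem x hx =>
    obtain ⟨w, ⟨hw, hwk⟩, rfl⟩ := hx
    exact mul_le_mul' le_rfl (wordSpan_mono v k hw) (h w hwk a ha)
  | zero => simp
  | add x y _ _ hx hy => rw [add_mul]; exact add_mem hx hy
  | smul c x _ hx => rw [smul_mul_assoc]; exact Submodule.smul_mem _ _ hx

/-- The ordered words with coefficients in `A` span the algebra generated by `A` and a letter. -/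
theorem adjoin_le_mul_span_sorted
    (hA : letterSpan v k * Subalgebra.toSubmodule A ≤ Subalgebra.toSubmodule A * letterSpan v k)
    (hv : ∀ x < k, ∀ y < k, ∃ c : ℂ, v y * v x - c • (v x * v y) ∈ A) {s : Set B}
    (hs : ∀ x ∈ s, x ∈ A ∨ x ∈ letterSpan v k) :
    Subalgebra.toSubmodule (Algebra.adjoin ℂ s) ≤ Subalgebra.toSubmodule A * Submodule.span ℂ
      (Set.range fun m : ℕ → ℕ => ((List.range k).map fun l => v l ^ m l).prod) := by
  -- `T` consists of all words with coefficients in `A` on the left. It contains $1$ and is stable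
  -- under right multiplication by `A` and by the letters, hence contains the whole generated
  -- algebra.
  set T : Submodule ℂ B := ⨆ d, Subalgebra.toSubmodule A * wordSpan v k d with hT
  have hTle : T ≤ Subalgebra.toSubmodule A * Submodule.span ℂ
      (Set.range fun m : ℕ → ℕ => ((List.range k).map fun l => v l ^ m l).prod) := by
    refine iSup_le fun d => ?_
    have := mul_le_mul' (le_refl (Subalgebra.toSubmodule A)) (wordSpan_le_mul_span_sorted hA hv d)
    rwa [toSubmodule_mul_mul] at this
  have hword : ∀ w : List ℕ, (∀ x ∈ w, x < k) → wordProd v w ∈ T := fun w hw =>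
    Submodule.mem_iSup_of_mem (w.length + 1)
      (le_toSubmodule_mul _ _ (wordProd_mem_wordSpan v (Nat.lt_succ_self _) hw))
  have h1 : (1 : B) ∈ T := by simpa [wordProd] using hword [] (by simp)
  have hAT : ∀ a ∈ A, ∀ t ∈ T, a * t ∈ T := by
    intro a ha t ht
    have := Submodule.mul_mem_mul (M := Subalgebra.toSubmodule A) ha ht
    rw [hT, Submodule.mul_iSup] at this
    simpa only [toSubmodule_mul_mul] using this
  have hTA : ∀ t ∈ T, ∀ a ∈ A, t * a ∈ T := by
    intro t ht a ha
    have := Submodule.mul_mem_mul (N := Subalgebra.toSubmodule A) ht ha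
    rw [hT, Submodule.iSup_mul] at this
    refine (iSup_mono fun d => ?_ : _ ≤ T) this
    rw [mul_assoc]
    have h2 := mul_le_mul' (le_refl (Subalgebra.toSubmodule A)) (wordSpan_mul_le hA d)
    rwa [toSubmodule_mul_mul] at h2
  have hTv : T * letterSpan v k ≤ T := by
    rw [hT, Submodule.iSup_mul]
    refine iSup_mono' fun d => ⟨d + 1, ?_⟩
    rw [mul_assoc]
    refine mul_le_mul' le_rfl ?_
    rw [letterSpan, wordSpan, Submodule.span_mul_span, Submodule.span_le]
    rintro _ ⟨_, ⟨w, hw, rfl⟩, _, ⟨l, hl, rfl⟩, rfl⟩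
    refine Submodule.subset_span ⟨w ++ [l], ⟨by simpa using hw.1, ?_⟩, by
      simp [wordProd]⟩
    intro x hx
    rcases List.mem_append.1 hx with hx | hx
    · exact hw.2 x hx
    · rw [List.mem_singleton.1 hx]
      exact hl
  have hsT : ∀ x ∈ s, ∀ t ∈ T, t * x ∈ T := by
    intro x hx t ht
    rcases hs x hx with h | h
    · exact hTA t ht x h
    · exact hTv (Submodule.mul_mem_mul ht h)
  have hadj : ∀ x ∈ Algebra.adjoin ℂ s, ∀ t ∈ T, t * x ∈ T := by
    intro x hx
    induction hx using Algebra.adjoin_induction with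
    | mem x hx => exact hsT x hx
    | algebraMap c =>
      intro t ht
      rw [← Algebra.commutes, ← Algebra.smul_def]
      exact Submodule.smul_mem _ _ ht
    | add x y _ _ hx hy =>
      intro t ht
      rw [mul_add]
      exact add_mem (hx t ht) (hy t ht)
    | mul x y _ _ hx hy =>
      intro t ht
      rw [← mul_assoc]
      exact hy _ (hx t ht)
  intro x hx
  exact hTle (by simpa using hadj x hx 1 h1)

end Reordering

/-! ### Ordered monomials span, row by row -/

section Spanning

variable {B : Type*} [Ring B] [Algebra ℂ B] {r : ℂ} {n : ℕ} {g : ℕ → B}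

theorem rootVec_mem_adjoin {l d N : ℕ} (h : l + d + 1 < N) :
    rootVec r g l d ∈ Algebra.adjoin ℂ (g '' {i | i + 1 < N}) := by
  have hg : ∀ i, i + 1 < N → g i ∈ Algebra.adjoin ℂ (g '' {i | i + 1 < N}) := fun i hi =>
    Algebra.subset_adjoin ⟨i, hi, rfl⟩
  induction d generalizing l with
  | zero => exact hg l h
  | succ d ih =>
    have h1 := hg l (by omega)
    have h2 := ih (l := l + 1) (by omega)
    exact sub_mem (Subalgebra.smul_mem _ (mul_mem h1 h2) r)
      (Subalgebra.smul_mem _ (mul_mem h2 h1) r⁻¹)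

namespace SoRelations

variable (H : SoRelations n (r ^ 2 + (r ^ 2)⁻¹) g)
include H

/-- The generator $g_i$ commutes with $I_{kl}$ unless $i=l-1$ or $i=l$. In these cases moving it to
the left produces an extra multiple of $I_{k,l-1}$, by the recursive definition, or of $I_{k,l+1}$,
by `qBracket_rootVec_gen`. -/
theorem rootVec_mul_gen_mem (hr : r ≠ 0) (hc : 4 ≤ n → r ^ 2 + (r ^ 2)⁻¹ ≠ 0) {k l i : ℕ}
    (hk : k < n) (hl : l < k) (hi : i + 1 < k) :
    rootVec r g l (k - l - 1) * g i ∈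
      Subalgebra.toSubmodule (Algebra.adjoin ℂ (g '' {i | i + 1 < k})) *
        letterSpan (fun l => rootVec r g l (k - l - 1)) k := by
  set A := Algebra.adjoin ℂ (g '' {i | i + 1 < k})
  set v := fun l => rootVec r g l (k - l - 1) with hv
  have hg : g i ∈ Subalgebra.toSubmodule A := Algebra.subset_adjoin ⟨i, hi, rfl⟩
  have hvm : ∀ l < k, v l ∈ letterSpan v k := fun l hl => Submodule.subset_span ⟨l, hl, rfl⟩
  have hgv : ∀ l < k, g i * v l ∈ Subalgebra.toSubmodule A * letterSpan v k := fun l hl =>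
    Submodule.mul_mem_mul hg (hvm l hl)
  have hv1 : ∀ l < k, v l ∈ Subalgebra.toSubmodule A * letterSpan v k := fun l hl =>
    le_toSubmodule_mul _ _ (hvm l hl)
  change v l * g i ∈ _
  rcases lt_trichotomy (i + 1) l with h | h | h
  · have := H.commute_rootVec_of_lt (r := r) (l := l) (d := k - l - 1) h (by omega)
    rw [show v l * g i = g i * v l from this.eq.symm]
    exact hgv l hl
  · subst h
    have e : v i = r • (g i * v (i + 1)) - r⁻¹ • (v (i + 1) * g i) := by
      simp only [hv]
      rw [show k - i - 1 = (k - (i + 1) - 1) + 1 by omega, rootVec, qBracket]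
    have e2 : v (i + 1) * g i = r ^ 2 • (g i * v (i + 1)) - r • v i := by
      rw [e, smul_sub, smul_smul, smul_smul, mul_inv_cancel₀ hr]
      module
    rw [e2]
    exact sub_mem (Submodule.smul_mem _ _ (hgv _ hl)) (Submodule.smul_mem _ _ (hv1 i (by omega)))
  · rcases (Nat.lt_succ_iff.1 h).eq_or_lt with rfl | h'
    · have e : r • (v l * g l) - r⁻¹ • (g l * v l) = v (l + 1) := by
        have := H.qBracket_rootVec_gen hr (l := l) (d := k - (l + 1) - 1) (by omega)
        rw [show k - (l + 1) - 1 + 1 = k - l - 1 by omega] at this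
        exact this
      have e2 : v l * g l = r⁻¹ • v (l + 1) + (r⁻¹ * r⁻¹) • (g l * v l) := by
        rw [← e, smul_sub, smul_smul, smul_smul, inv_mul_cancel₀ hr]
        module
      rw [e2]
      exact add_mem (Submodule.smul_mem _ _ (hv1 _ hi)) (Submodule.smul_mem _ _ (hgv l hl))
    · have := H.commute_rootVec_of_mem hr hc (i := i) (l := l) (d := k - l - 1) h' (by omega)
        (by omega)
      rw [show v l * g i = g i * v l from this.eq.symm]
      exact hgv l hl

theorem letterSpan_mul_adjoin_le (hr : r ≠ 0) (hc : 4 ≤ n → r ^ 2 + (r ^ 2)⁻¹ ≠ 0) {k : ℕ}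
    (hk : k < n) :
    letterSpan (fun l => rootVec r g l (k - l - 1)) k *
        Subalgebra.toSubmodule (Algebra.adjoin ℂ (g '' {i | i + 1 < k})) ≤
      Subalgebra.toSubmodule (Algebra.adjoin ℂ (g '' {i | i + 1 < k})) *
        letterSpan (fun l => rootVec r g l (k - l - 1)) k := by
  set A := Algebra.adjoin ℂ (g '' {i | i + 1 < k}) with hA
  set V := letterSpan (fun l => rootVec r g l (k - l - 1)) k with hV
  have h : ∀ a ∈ A, ∀ x ∈ Subalgebra.toSubmodule A * V, x * a ∈ Subalgebra.toSubmodule A * V := by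
    have hext : ∀ a, (∀ y ∈ V, y * a ∈ Subalgebra.toSubmodule A * V) →
        ∀ x ∈ Subalgebra.toSubmodule A * V, x * a ∈ Subalgebra.toSubmodule A * V := by
      intro a ha x hx
      induction hx using Submodule.mul_induction_on' with
      | mem_mul_mem b hb y hy =>
        rw [mul_assoc, ← toSubmodule_mul_mul]
        exact Submodule.mul_mem_mul hb (ha y hy)
      | add x _ y _ hx hy =>
        rw [add_mul]
        exact add_mem hx hy
    intro a ha
    induction ha using Algebra.adjoin_induction with
    | mem a ha =>
      obtain ⟨i, hi, rfl⟩ := ha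
      refine hext _ fun y hy => ?_
      induction hy using Submodule.span_induction with
      | mem y hy =>
        obtain ⟨l, hl, rfl⟩ := hy
        exact H.rootVec_mul_gen_mem hr hc hk hl hi
      | zero => simp
      | add x y _ _ hx hy => rw [add_mul]; exact add_mem hx hy
      | smul c x _ hx => rw [smul_mul_assoc]; exact Submodule.smul_mem _ _ hx
    | algebraMap c =>
      intro x hx
      rw [← Algebra.commutes, ← Algebra.smul_def]
      exact Submodule.smul_mem _ _ hx
    | add a b _ _ ha hb =>
      intro x hx
      rw [mul_add]
      exact add_mem (ha x hx) (hb x hx)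
    | mul a b _ _ ha hb =>
      intro x hx
      rw [← mul_assoc]
      exact hb _ (ha x hx)
  rw [Submodule.mul_le]
  exact fun y hy a ha => h a ha y (le_toSubmodule_mul _ _ hy)

theorem exists_rootVec_commutator_mem (hr : r ≠ 0) (hc : 4 ≤ n → r ^ 2 + (r ^ 2)⁻¹ ≠ 0) {k : ℕ}
    (hk : k < n) {x y : ℕ} (hx : x < k) (hy : y < k) :
    ∃ c : ℂ, rootVec r g y (k - y - 1) * rootVec r g x (k - x - 1) -
        c • (rootVec r g x (k - x - 1) * rootVec r g y (k - y - 1)) ∈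
      Algebra.adjoin ℂ (g '' {i | i + 1 < k}) := by
  have key : ∀ x y : ℕ, x < y → y < k →
      qBracket r (rootVec r g y (k - y - 1)) (rootVec r g x (k - x - 1)) ∈
        Algebra.adjoin ℂ (g '' {i | i + 1 < k}) := by
    intro x y hxy hy
    have h := H.qBracket_rootVec_rootVec hr hc (m := x) (e := y - x - 1) (d := k - y - 1)
      (by omega)
    rw [show x + (y - x - 1) + 1 = y by omega,
      show y - x - 1 + (k - y - 1) + 1 = k - x - 1 by omega] at h
    rw [h]
    exact rootVec_mem_adjoin (by omega)
  rcases lt_trichotomy x y with h | rfl | h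
  · refine ⟨r⁻¹ * r⁻¹, ?_⟩
    have := Subalgebra.smul_mem _ (key x y h hy) r⁻¹
    rwa [qBracket, smul_sub, smul_smul, smul_smul, inv_mul_cancel₀ hr, one_smul] at this
  · exact ⟨1, by simp⟩
  · refine ⟨r * r, ?_⟩
    have := Subalgebra.smul_mem _ (key y x h hx) (-r)
    rw [qBracket, smul_sub, smul_smul, smul_smul, neg_mul, neg_mul, mul_inv_cancel₀ hr] at this
    convert this using 1
    module

theorem adjoin_le_span_orderedMonomial (hr : r ≠ 0) (hc : 4 ≤ n → r ^ 2 + (r ^ 2)⁻¹ ≠ 0) {N : ℕ}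
    (hN : N ≤ n) :
    Subalgebra.toSubmodule (Algebra.adjoin ℂ (g '' {i | i + 1 < N})) ≤
      Submodule.span ℂ (Set.range fun m => orderedMonomial r g m N) := by
  induction N with
  | zero =>
    have : {i : ℕ | i + 1 < 0} = ∅ := by ext; simp
    rw [this, Set.image_empty, Algebra.adjoin_empty, Algebra.toSubmodule_bot,
      Submodule.one_eq_span]
    exact Submodule.span_mono (by simp [orderedMonomial])
  | succ k ih =>
    refine (adjoin_le_mul_span_sorted (H.letterSpan_mul_adjoin_le hr hc hN)
      (fun x hx y hy => H.exists_rootVec_commutator_mem hr hc hN hx hy) ?_).trans ?_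
    · rintro _ ⟨i, hi, rfl⟩
      rcases (Nat.lt_succ_iff.1 hi).lt_or_eq with h | h
      · exact Or.inl (Algebra.subset_adjoin ⟨i, h, rfl⟩)
      -- The one new generator has $i+1=k$ and is itself the letter $I_{k,k-1}$.
      · refine Or.inr (Submodule.subset_span ⟨i, by simp; omega, ?_⟩)
        simp [← h, rootVec]
    · refine (mul_le_mul' (ih (by omega)) le_rfl).trans ?_
      rw [Submodule.span_mul_span, Submodule.span_le]
      rintro _ ⟨_, ⟨m, rfl⟩, _, ⟨p, rfl⟩, rfl⟩
      refine Submodule.subset_span ⟨fun j => if j = k then p else m j, ?_⟩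
      change orderedMonomial r g _ (k + 1) = orderedMonomial r g m k * rowMonomial r g k p k
      rw [orderedMonomial_succ, if_pos rfl]
      congr 1
      unfold orderedMonomial
      congr 1
      refine List.map_congr_left fun j hj => ?_
      simp only [if_neg (List.mem_range.1 hj).ne]

end SoRelations

end Spanning

/-! ### Spanning in the presented algebra -/

section Generation

variable {n : ℕ} {q r : ℂ}

theorem soRelations_genNat (n : ℕ) (q : ℂ) : SoRelations n (q + q⁻¹) (genNat n q) where
  succ i hi := by
    have := RingQuot.mkAlgHom_rel ℂ (Rel.serre_left (n := n) (q := q) ⟨i, by omega⟩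
      ⟨i + 1, by omega⟩ rfl)
    rw [genNat, genNat, dif_pos (by omega), dif_pos (by omega)]
    simpa [serre, gen] using this
  pred i hi := by
    have := RingQuot.mkAlgHom_rel ℂ (Rel.serre_right (n := n) (q := q) ⟨i, by omega⟩
      ⟨i + 1, by omega⟩ rfl)
    rw [genNat, genNat, dif_pos (by omega), dif_pos (by omega)]
    simp only [map_add, map_sub, map_mul, map_pow, map_smul, map_neg] at this
    simp only [serre, gen]
    rw [← this]
    abel
  comm i j hij hj := by
    have := RingQuot.mkAlgHom_rel ℂ (Rel.comm (n := n) (q := q) ⟨i, by omega⟩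
      ⟨j, by omega⟩ (Or.inl hij))
    rw [genNat, genNat, dif_pos (by omega), dif_pos (by omega)]
    simp only [map_sub, map_mul, map_zero] at this
    exact sub_eq_zero.1 this

theorem adjoin_genNat (n : ℕ) (q : ℂ) :
    Algebra.adjoin ℂ (genNat n q '' {i | i + 1 < n}) = ⊤ := by
  rw [eq_top_iff]
  have h : (Algebra.adjoin ℂ (Set.range (FreeAlgebra.ι ℂ (X := GenIdx n)))).map
      (RingQuot.mkAlgHom ℂ (Rel n q)) = ⊤ := by
    rw [FreeAlgebra.adjoin_range_ι, Algebra.map_top, AlgHom.range_eq_top]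
    exact RingQuot.mkAlgHom_surjective ℂ _
  rw [← h, AlgHom.map_adjoin]
  refine Algebra.adjoin_mono ?_
  rintro _ ⟨_, ⟨i, rfl⟩, rfl⟩
  refine ⟨i.1, i.2, ?_⟩
  rw [genNat, dif_pos i.2]
  rfl

theorem span_monomial (hr : r ≠ 0) (hqr : q + q⁻¹ = r ^ 2 + (r ^ 2)⁻¹)
    (hc : 4 ≤ n → q + q⁻¹ ≠ 0) : Submodule.span ℂ (Set.range (monomial n q r)) = ⊤ := by
  have H := soRelations_genNat n q
  rw [hqr] at H hc
  have h := H.adjoin_le_span_orderedMonomial hr hc le_rfl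
  rw [adjoin_genNat, Algebra.top_toSubmodule, top_le_iff] at h
  rw [← top_le_iff, ← h]
  refine Submodule.span_mono ?_
  rintro _ ⟨m, rfl⟩
  refine ⟨fun k l => m k l, ?_⟩
  rw [monomial_eq_orderedMonomial]
  unfold orderedMonomial
  congr 1
  refine List.map_congr_left fun k hk => ?_
  unfold rowMonomial
  congr 1
  refine List.map_congr_left fun l hl => ?_
  simp [extendExp, List.mem_range.1 hk, List.mem_range.1 hl]

end Generation

end QSo

end

/-- `s` is a square root `q^{1/2}` of `q`. -/
theorem theorem2 (n : ℕ) (q s : ℂ) (hq : q ≠ 0) (hs : s ^ 2 = q)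
    (hq4 : 4 ≤ n → q ^ 2 ≠ -1) :
    (LinearIndependent ℂ (QSo.monomial n q s) ∧
      Submodule.span ℂ (Set.range (QSo.monomial n q s)) = ⊤) ∧
    (LinearIndependent ℂ (QSo.monomial n q s⁻¹) ∧
      Submodule.span ℂ (Set.range (QSo.monomial n q s⁻¹)) = ⊤) := by
  have hs0 : s ≠ 0 := by
    rintro rfl
    exact hq (by simpa using hs.symm)
  have h1 : q + q⁻¹ = s ^ 2 + (s ^ 2)⁻¹ := by rw [hs]
  -- The elements $I^-$ are obtained with $r=s^{-1}$ in the same algebra, since the relations are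
  -- symmetric in $q$ and $q^{-1}$.
  have h2 : q + q⁻¹ = s⁻¹ ^ 2 + (s⁻¹ ^ 2)⁻¹ := by rw [inv_pow, hs, inv_inv, add_comm]
  have hc : 4 ≤ n → q + q⁻¹ ≠ 0 := fun hn h => hq4 hn (by
    field_simp at h
    linear_combination h)
  exact ⟨⟨QSo.linearIndependent_monomial hs0 h1, QSo.span_monomial hs0 h1 hc⟩,
    QSo.linearIndependent_monomial (inv_ne_zero hs0) h2,
    QSo.span_monomial (inv_ne_zero hs0) h2 hc⟩
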